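/- Let $G$ be a connected compact Lie group, $H,K\subseteq G$ subgroups and $n\ge 1$. Consider the linear graph with edges $e_1,\dots,e_n$ and vertices $v_1,\dots,v_{n+1}$, where $e_i$ runs from $v_i$ to $v_{i+1}$, with local gauge groups $K_{v_1}=H$, $K_{v_i}=G$ for $2\le i\le n$, and $K_{v_{n+1}}=K$. The gauge group $\mathbf K=H\times G^{n-1}\times K$ acts on $G^n$ by $$(k_1,\dots,k_{n+1})\cdot(g_1,\dots,g_n)=(k_1g_1k_2^{-1},\,k_2g_2k_3^{-1},\dots,k_ng_nk_{n+1}^{-1}).$$ Let $L$, $S_i$ ($2\le i\le n$) and $N$ be finite dimensional complex representations of $H$, $G$ and $K$ respectively. Put $\underline S=S_2\otimes\cdots\otimes S_n$ (equal to $\mathbb C$ if $n=1$) and $\mathbf S=L\otimes\underline S\otimes N$, with the tensor product representation $\boldsymbol\sigma$ of $\mathbf K$. Let $\pi_i:G\to \mathrm{GL}(M^{\pi_i})$ ($1\le i\le n$) be finite dimensional irreducible continuous complex representations, and let $\boldsymbol\pi$ be the representation of $G^n$ on $M^{\pi_1}\otimes\cdots\otimes M^{\pi_n}$ given by $\boldsymbol\pi(g_1,\dots,g_n)=\pi_1(g_1)\otimes\cdots\otimes\pi_n(g_n)$.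 Let $\mathcal R^{\boldsymbol\pi}(G^n)\subseteq C(G^n)$ be the span of the matrix coefficients of $\boldsymbol\pi$, and let $(\mathcal R^{\boldsymbol\pi}(G^n)\otimes\mathbf S)^{\mathbf K}$, the space of $\boldsymbol\pi$-elementary spin graph functions, be the space of $\mathbf S$-valued functions $f\in\mathcal R^{\boldsymbol\pi}(G^n)\otimes\mathbf S$ on $G^n$ such that $f(\mathbf k\cdot\mathbf g)=\boldsymbol\sigma(\mathbf k)f(\mathbf g)$ for all $\mathbf k\in\mathbf K$ and $\mathbf g\in G^n$. For a vector space $X$ and a linear map $T:N^*\to X$ put $Q(T)=\sum_jT(n_j^*)\otimes n_j\in X\otimes N$, with $\{n_j\}$ a basis of $N$ and $\{n_j^*\}$ the dual basis of $N^*$; this does not depend on the basis. Then there is a linear isomorphism $$\mathrm{Hom}_H(M^{\pi_1},L)\otimes\bigotimes_{i=2}^n\mathrm{Hom}_G(M^{\pi_i},M^{\pi_{i-1}}\otimes S_i)\otimes\mathrm{Hom}_K(N^*,M^{\pi_n})\;\xrightarrow{\ \sim\ }\;(\mathcal R^{\boldsymbol\pi}(G^n)\otimes\mathbf S)^{\mathbf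 K}$$ which maps $\Theta\otimes\bigl(\bigotimes_{i=2}^n\Phi_i\bigr)\otimes\Xi$ to the function $$f(\mathbf g)=Q\Bigl((\Theta\pi_1(g_1)\otimes\mathrm{id}_{\underline S})(\Phi_2\pi_2(g_2)\otimes\mathrm{id}_{S_3\otimes\cdots\otimes S_n})\cdots(\Phi_{n-1}\pi_{n-1}(g_{n-1})\otimes\mathrm{id}_{S_n})\,\Phi_n\pi_n(g_n)\,\Xi\Bigr),$$ which for $n=1$ reads $f(g)=Q(\Theta\pi_1(g)\Xi)$. Here $M^{\pi_1}$ and $M^{\pi_n}$ are restricted to $H$ and $K$, $M^{\pi_{i-1}}\otimes S_i$ carries the diagonal $G$-action and $N^*$ the dual $K$-action. -/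

import Mathlib

open scoped TensorProduct Manifold ContDiff

noncomputable section

namespace SpinGraph

universe u v

/-! ### Representations -/

/-- Continuity of a finite dimensional complex representation `ρ` of a topological group: all its
matrix coefficients are continuous.  For finite dimensional `V` this is the continuity of `ρ` for
the (unique Hausdorff) vector space topology. -/
def IsContinuousRep {G V : Type*} [Monoid G] [TopologicalSpace G] [AddCommGroup V] [Module ℂ V]
    (ρ : Representation ℂ G V) : Prop :=
  ∀ (φ : Module.Dual ℂ V) (m : V), Continuous fun g : G => φ (ρ g m)

/-- The space `R^ρ(G)` of representative functions spanned by the matrix coefficients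
`g ↦ φ (ρ g m)` of `ρ`, inside the continuous complex functions on `G`. -/
def repFunctions {G V : Type*} [Monoid G] [TopologicalSpace G] [AddCommGroup V] [Module ℂ V]
    (ρ : Representation ℂ G V) : Submodule ℂ C(G, ℂ) :=
  Submodule.span ℂ {c | ∃ (φ : Module.Dual ℂ V) (m : V), ∀ g, c g = φ (ρ g m)}

/-- The (external) tensor product representation of a product group on `⨂ i, V i`. -/
def piTensorRep {ι : Type*} {G : ι → Type*} [∀ i, Monoid (G i)] {V : ι → Type*}
    [∀ i, AddCommGroup (V i)] [∀ i, Module ℂ (V i)] (ρ : ∀ i, Representation ℂ (G i) (V i)) :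
    Representation ℂ (∀ i, G i) (⨂[ℂ] i, V i) where
  toFun g := PiTensorProduct.map fun i => ρ i (g i)
  map_one' := by
    simp only [Pi.one_apply, map_one]
    exact PiTensorProduct.map_one
  map_mul' g h := by
    simp only [Pi.mul_apply, map_mul]
    exact PiTensorProduct.map_mul _ _

/-- Restriction of a representation to a subgroup. -/
def resRep {G V : Type*} [Group G] [AddCommGroup V] [Module ℂ V] (ρ : Representation ℂ G V)
    (H : Subgroup G) : Representation ℂ H V :=
  MonoidHom.comp ρ H.subtype

/-! ### Spin graph functions on an oriented graph -/

/-- An oriented graph with vertex set `V` and edge set `E` (loops and multiple edges allowed). -/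
structure OrientedGraph (V E : Type*) where
  source : E → V
  target : E → V

/-- The gauge group `𝐊 = ∏ v, K v` of a family of local gauge groups. -/
abbrev GaugeGroup {V G : Type*} [Group G] (K : V → Subgroup G) : Type _ := ∀ v, K v

/-- The gauge action `(k · g)_e = k_{s(e)} g_e k_{t(e)}⁻¹` on graph connections. -/
def gaugeAct {V E G : Type*} [Group G] (Γ : OrientedGraph V E) {K : V → Subgroup G}
    (k : GaugeGroup K) (g : E → G) : E → G :=
  fun e => (k (Γ.source e) : G) * g e * (k (Γ.target e) : G)⁻¹

/-- For a space `R` of continuous functions on `X`, the space `R ⊗ S` of `S`-valued functions on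
`X`: the span of the functions `c ⊗ u : x ↦ c x • u` with `c` in `R` and `u` in `S`. -/
def spinValued {X : Type*} [TopologicalSpace X] (R : Submodule ℂ C(X, ℂ)) (S : Type*)
    [AddCommGroup S] [Module ℂ S] : Submodule ℂ (X → S) :=
  Submodule.span ℂ {f | ∃ c ∈ R, ∃ u : S, f = fun x => c x • u}

/-- The space `H^π = (R^π(G^E) ⊗ S)^𝐊` of `π`-elementary spin graph functions: the `S`-valued
functions `f` on `G^E` that lie in `R^π(G^E) ⊗ S` and satisfy `f (k · g) = σ(k) f(g)`. -/
def elementarySpinGraphFunctions {V E G : Type*} [Group G] [TopologicalSpace G]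
    (Γ : OrientedGraph V E) (K : V → Subgroup G)
    {M : Type*} [AddCommGroup M] [Module ℂ M] (π : Representation ℂ (E → G) M)
    {S : Type*} [AddCommGroup S] [Module ℂ S] (σ : Representation ℂ (GaugeGroup K) S) :
    Submodule ℂ ((E → G) → S) where
  carrier := {f | f ∈ spinValued (repFunctions π) S ∧
    ∀ (k : GaugeGroup K) (g : E → G), f (gaugeAct Γ k g) = σ k (f g)}
  add_mem' hf hf' := ⟨add_mem hf.1 hf'.1, fun k g => by simp [hf.2 k g, hf'.2 k g]⟩
  zero_mem' := ⟨zero_mem _, fun k g => by simp⟩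
  smul_mem' a f hf := ⟨Submodule.smul_mem _ a hf.1, fun k g => by simp [hf.2 k g]⟩

/-! ### The linearly ordered linear graph -/

/-- The linear graph with `m + 1` edges `0, …, m` and `m + 2` vertices `0, …, m + 1`; the edge `i`
runs from the vertex `i` to the vertex `i + 1`. -/
def linearGraph (m : ℕ) : OrientedGraph (Fin (m + 2)) (Fin (m + 1)) where
  source := Fin.castSucc
  target := Fin.succ

/-- The local gauge groups `H, G, …, G, K` along the vertices of the linear graph. -/
def linearGauge {G : Type*} [Group G] (m : ℕ) (H K : Subgroup G) : Fin (m + 2) → Subgroup G :=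
  fun v => if v = 0 then H else if v = Fin.last (m + 1) then K else ⊤

theorem linearGauge_zero {G : Type*} [Group G] (m : ℕ) (H K : Subgroup G) :
    linearGauge m H K 0 = H := by simp [linearGauge]

theorem linearGauge_last {G : Type*} [Group G] (m : ℕ) (H K : Subgroup G) :
    linearGauge m H K (Fin.last (m + 1)) = K := by simp [linearGauge, Fin.ext_iff]

theorem linearGauge_bulk {G : Type*} [Group G] (m : ℕ) (H K : Subgroup G) (j : Fin m) :
    linearGauge m H K j.succ.castSucc = ⊤ := by
  have := j.isLt
  simp only [linearGauge, Fin.ext_iff, Fin.val_castSucc, Fin.val_succ, Fin.val_zero, Fin.val_last]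
  rw [if_neg (by omega), if_neg (by omega)]

/-- The component in `H` at the first vertex. -/
def gaugeFirst {G : Type*} [Group G] (m : ℕ) (H K : Subgroup G) :
    GaugeGroup (linearGauge m H K) →* H where
  toFun k := ⟨(k 0 : G), (linearGauge_zero m H K).le (k 0).2⟩
  map_one' := rfl
  map_mul' _ _ := rfl

/-- The components in `G` at the interior vertices. -/
def gaugeBulk {G : Type*} [Group G] (m : ℕ) (H K : Subgroup G) :
    GaugeGroup (linearGauge m H K) →* (Fin m → G) where
  toFun k j := (k j.succ.castSucc : G)
  map_one' := rfl
  map_mul' _ _ := rfl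

/-- The component in `K` at the last vertex. -/
def gaugeLast {G : Type*} [Group G] (m : ℕ) (H K : Subgroup G) :
    GaugeGroup (linearGauge m H K) →* K where
  toFun k := ⟨(k (Fin.last (m + 1)) : G),
    (linearGauge_last m H K).le (k (Fin.last (m + 1))).2⟩
  map_one' := rfl
  map_mul' _ _ := rfl

/-- The tensor product spin representation of `𝐊 = H × G^m × K` on
`𝐒 = L ⊗ (⨂ j, S j) ⊗ N`. -/
def linearSpinRep {G : Type*} [Group G] (m : ℕ) (H K : Subgroup G)
    {L : Type*} [AddCommGroup L] [Module ℂ L] (σL : Representation ℂ H L)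
    {S : Fin m → Type*} [∀ j, AddCommGroup (S j)] [∀ j, Module ℂ (S j)]
    (σ : ∀ j, Representation ℂ G (S j))
    {N : Type*} [AddCommGroup N] [Module ℂ N] (σN : Representation ℂ K N) :
    Representation ℂ (GaugeGroup (linearGauge m H K)) ((L ⊗[ℂ] (⨂[ℂ] j, S j)) ⊗[ℂ] N) :=
  Representation.tprod
    (Representation.tprod
      (MonoidHom.comp σL (gaugeFirst m H K) : Representation ℂ _ L)
      (MonoidHom.comp (piTensorRep σ) (gaugeBulk m H K) : Representation ℂ _ (⨂[ℂ] j, S j)))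
    (MonoidHom.comp σN (gaugeLast m H K) : Representation ℂ _ N)

/-! ### The `n`-point spherical functions -/

/-- The identification `S 0 ⊗ (S 1 ⊗ ⋯ ⊗ S m) → S 0 ⊗ S 1 ⊗ ⋯ ⊗ S m`. -/
def tensorCons {m : ℕ} (S : Fin (m + 1) → Type*) [∀ j, AddCommGroup (S j)] [∀ j, Module ℂ (S j)] :
    S 0 ⊗[ℂ] (⨂[ℂ] j : Fin m, S j.succ) →ₗ[ℂ] ⨂[ℂ] j, S j :=
  TensorProduct.lift
    (PiTensorProduct.lift.toLinearMap ∘ₗ (PiTensorProduct.tprod ℂ (s := S)).curryLeft)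

theorem tensorCons_tmul_tprod {m : ℕ} (S : Fin (m + 1) → Type*) [∀ j, AddCommGroup (S j)]
    [∀ j, Module ℂ (S j)] (x : S 0) (y : ∀ j : Fin m, S j.succ) :
    tensorCons S (x ⊗ₜ PiTensorProduct.tprod ℂ y) =
      PiTensorProduct.tprod ℂ (Fin.cons x y : ∀ j, S j) := by
  simp [tensorCons]

/-- For `T : B → A ⊗ C` and `c : C ⊗ P → P'`, the composition of `T ⊗ id_P : B ⊗ P → A ⊗ C ⊗ P`
with `id_A ⊗ c`. -/
def chainStep {A B C P P' : Type*} [AddCommGroup A] [Module ℂ A] [AddCommGroup B] [Module ℂ B]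
    [AddCommGroup C] [Module ℂ C] [AddCommGroup P] [Module ℂ P] [AddCommGroup P'] [Module ℂ P']
    (T : B →ₗ[ℂ] A ⊗[ℂ] C) (c : C ⊗[ℂ] P →ₗ[ℂ] P') : B ⊗[ℂ] P →ₗ[ℂ] A ⊗[ℂ] P' :=
  LinearMap.lTensor A c ∘ₗ (TensorProduct.assoc ℂ A C P).toLinearMap ∘ₗ LinearMap.rTensor P T

/-- For maps `T j : M (j + 1) → M j ⊗ S j`, the composition
`(T 0 ⊗ id_{S 1 ⊗ ⋯ ⊗ S (m-1)}) ⋯ (T (m-2) ⊗ id_{S (m-1)}) (T (m-1))`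
from `M m` to `M 0 ⊗ S 0 ⊗ ⋯ ⊗ S (m-1)`; for `m = 0` it is the identity of `M 0`
(the empty tensor product being the ground field). -/
def chainComp : (m : ℕ) → (M : Fin (m + 1) → Type u) → [∀ i, AddCommGroup (M i)] →
    [∀ i, Module ℂ (M i)] → (S : Fin m → Type v) → [∀ j, AddCommGroup (S j)] →
    [∀ j, Module ℂ (S j)] →
    (T : ∀ j : Fin m, M j.succ →ₗ[ℂ] M j.castSucc ⊗[ℂ] S j) →
    (M (Fin.last m) →ₗ[ℂ] M 0 ⊗[ℂ] (⨂[ℂ] j, S j))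
  | 0, M, _, _, S, _, _, _ =>
      LinearMap.lTensor (M 0) (PiTensorProduct.isEmptyEquiv (R := ℂ) (s := S) (Fin 0)).symm.toLinearMap
        ∘ₗ (TensorProduct.rid ℂ (M 0)).symm.toLinearMap
  | m + 1, M, _, _, S, _, _, T =>
      chainStep (A := M 0) (C := S 0) (T 0) (tensorCons S)
        ∘ₗ chainComp m (fun i => M i.succ) (fun j => S j.succ) (fun j => T j.succ)

/-- The isomorphism `Q : Hom(N^*, X) → X ⊗ N`, `Q(T) = ∑ j, T(n_j^*) ⊗ n_j`, with `n_j` a basis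
of `N` and `n_j^*` the dual basis. -/
def spinQ {X N : Type*} [AddCommGroup X] [Module ℂ X] [AddCommGroup N] [Module ℂ N]
    [FiniteDimensional ℂ N] (T : Module.Dual ℂ N →ₗ[ℂ] X) : X ⊗[ℂ] N :=
  ∑ j, T ((Module.finBasis ℂ N).coord j) ⊗ₜ[ℂ] Module.finBasis ℂ N j

/-- `Q` does not depend on the basis. -/
theorem spinQ_eq_sum {X N : Type*} [AddCommGroup X] [Module ℂ X] [AddCommGroup N] [Module ℂ N]
    [FiniteDimensional ℂ N] (T : Module.Dual ℂ N →ₗ[ℂ] X) {ι : Type*} [Fintype ι]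
    (b : Module.Basis ι ℂ N) : spinQ T = ∑ j, T (b.coord j) ⊗ₜ[ℂ] b j := by
  set c := Module.finBasis ℂ N with hc
  have h1 : ∀ j, c.coord j = ∑ i, c.coord j (b i) • b.coord i := by
    intro j
    apply b.ext
    intro k
    classical
    simp [LinearMap.sum_apply, Finsupp.single_apply]
  have h2 : ∀ i, b i = ∑ j, c.coord j (b i) • c j := by
    intro i
    simp [c.sum_repr]
  calc spinQ T = ∑ j, T (∑ i, c.coord j (b i) • b.coord i) ⊗ₜ[ℂ] c j :=
        Finset.sum_congr rfl fun j _ => by rw [← h1 j]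
    _ = ∑ j, ∑ i, T (b.coord i) ⊗ₜ[ℂ] (c.coord j (b i) • c j) := by
        simp only [map_sum, map_smul, TensorProduct.sum_tmul, TensorProduct.smul_tmul]
    _ = ∑ i, ∑ j, T (b.coord i) ⊗ₜ[ℂ] (c.coord j (b i) • c j) := Finset.sum_comm
    _ = ∑ i, T (b.coord i) ⊗ₜ[ℂ] b i :=
        Finset.sum_congr rfl fun i _ => by rw [← TensorProduct.tmul_sum, ← h2 i]

/-- The function
`f(g) = Q((Θ π_0(g_0) ⊗ id) (Φ_0 π_1(g_1) ⊗ id) ⋯ (Φ_{m-1} π_m(g_m)) Ξ)` on `G^{m+1}`;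
here the edges are numbered `0, …, m` and `Φ_j` sits at the vertex between the edges
`j` and `j + 1`. -/
def sphericalFunction {G : Type*} [Group G] {m : ℕ}
    {M : Fin (m + 1) → Type*} [∀ i, AddCommGroup (M i)] [∀ i, Module ℂ (M i)]
    (π : ∀ i, Representation ℂ G (M i))
    {L : Type*} [AddCommGroup L] [Module ℂ L]
    {S : Fin m → Type*} [∀ j, AddCommGroup (S j)] [∀ j, Module ℂ (S j)]
    {N : Type*} [AddCommGroup N] [Module ℂ N] [FiniteDimensional ℂ N]
    (Θ : M 0 →ₗ[ℂ] L) (Φ : ∀ j : Fin m, M j.succ →ₗ[ℂ] M j.castSucc ⊗[ℂ] S j)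
    (Ξ : Module.Dual ℂ N →ₗ[ℂ] M (Fin.last m)) (g : Fin (m + 1) → G) :
    (L ⊗[ℂ] (⨂[ℂ] j, S j)) ⊗[ℂ] N :=
  spinQ (LinearMap.rTensor (⨂[ℂ] j, S j) (Θ ∘ₗ π 0 (g 0))
    ∘ₗ chainComp m M S (fun j => Φ j ∘ₗ π j.succ (g j.succ))
    ∘ₗ Ξ)

end SpinGraph

end

/-! Forget equivariance and let D = Hom(M_0, L) ⊗ ⨂ Hom(M_{j+1}, M_j ⊗ S_j) ⊗ Hom(N^*, M_m). The
formula for f makes sense on all of D and is linear there (`sphericalMap`). On rank one factors the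
chain collapses: f(g) is the product over the edges of the coefficients φ_i(π_i(g_i) x_i), times a
constant pure tensor (`sphericalMap_rankOne`). Thus D is regrouped as ⨂ (M_i^* ⊗ M_i) ⊗ 𝐒, and the
map takes matrix coefficients. Its range is R^π ⊗ 𝐒 (`range_sphericalMap`). It is injective because
by Burnside the π_i(g) span End(M_i), so that coefficients in a basis are independent.

The gauge group acts on D by conjugation at each vertex, and f_{k·d}(k·g) = σ(k) f_d(g), the gauge
factors cancelling along the chain (`sphericalFunction_gaugeAct`). By injectivity, f_d is
equivariant exactly when d is fixed.

It remains to see that the fixed vectors of H × G^m × K on the tensor product D are the tensor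
product of the factorwise fixed vectors, which are the intertwiners. This is done by duality instead
of averaging: a functional vanishing on the common fixed vectors of the ρ(g) is a combination of
functionals ψ ∘ (ρ(g) − 1) (`map_eq_of_eq_on_fixed`). Hence a fixed tensor is unchanged by any
operator, applied in one slot, that is the identity on the fixed vectors of that slot. A linear
retraction onto the intertwiners is such an operator (`mem_range_map_of_fixed`). -/

noncomputable section

namespace SpinGraph

universe u v

/-! ### Generalities on spans and tensor products -/

/-- A linear map which is independent on a finite spanning family is injective. -/
theorem injective_of_span_eq_top {V W ι : Type*} [AddCommMonoid V] [Module ℂ V] [AddCommGroup W]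
    [Module ℂ W] [Finite ι] (f : V →ₗ[ℂ] W) (v : ι → V) (hv : Submodule.span ℂ (Set.range v) = ⊤)
    (hf : LinearIndependent ℂ fun i => f (v i)) : Function.Injective f := by
  have := Fintype.ofFinite ι
  intro s t hst
  obtain ⟨c, rfl⟩ :=
    (Submodule.mem_span_range_iff_exists_fun ℂ).1 (hv.ge (Submodule.mem_top (x := s)))
  obtain ⟨d, rfl⟩ :=
    (Submodule.mem_span_range_iff_exists_fun ℂ).1 (hv.ge (Submodule.mem_top (x := t)))
  have h0 := Fintype.linearIndependent_iff.1 hf (c - d) (by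
    simpa [sub_smul, Finset.sum_sub_distrib, sub_eq_zero] using hst)
  rw [sub_eq_zero.1 (funext h0)]

theorem span_tmul_range_eq_top {V W ι κ : Type*} [AddCommMonoid V] [Module ℂ V] [AddCommMonoid W]
    [Module ℂ W] {v : ι → V} {w : κ → W} (hv : Submodule.span ℂ (Set.range v) = ⊤)
    (hw : Submodule.span ℂ (Set.range w) = ⊤) :
    Submodule.span ℂ (Set.range fun p : ι × κ => v p.1 ⊗ₜ[ℂ] w p.2) = ⊤ := by
  rw [← TensorProduct.map₂_mk_top_top_eq_top, ← hv, ← hw, Submodule.map₂_span_span,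
    Set.image2_range]
  rfl

/-- The rank one maps built from a frame `(f i, e i)` of `V` and a spanning family of `W` span
`Hom(V, W)`. -/
theorem span_smulRight_eq_top {V W ι κ : Type*} [AddCommGroup V] [Module ℂ V] [AddCommGroup W]
    [Module ℂ W] [Fintype ι] (f : ι → Module.Dual ℂ V) (e : ι → V)
    (hfe : ∀ v, ∑ i, f i v • e i = v) {w : κ → W} (hw : Submodule.span ℂ (Set.range w) = ⊤) :
    Submodule.span ℂ (Set.range fun p : ι × κ => (f p.1).smulRight (w p.2)) = ⊤ := by
  rw [eq_top_iff]
  rintro T -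
  have hT : T = ∑ i, (f i).smulRight (T (e i)) := by
    ext v
    conv_lhs => rw [← hfe v]
    simp
  rw [hT]
  refine Submodule.sum_mem _ fun i _ => ?_
  have hi : T (e i) ∈ Submodule.span ℂ (Set.range w) := hw ▸ Submodule.mem_top
  refine Submodule.span_induction (p := fun y _ => (f i).smulRight y ∈ _) ?_ ?_ ?_ ?_ hi
  · rintro _ ⟨k, rfl⟩
    exact Submodule.subset_span ⟨(i, k), rfl⟩
  · simp
  · intro y z _ _ hy hz
    have : (f i).smulRight (y + z) = (f i).smulRight y + (f i).smulRight z := by ext; simp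
    exact this ▸ add_mem hy hz
  · intro a y _ hy
    have : (f i).smulRight (a • y) = a • (f i).smulRight y := by
      ext v; exact smul_comm (f i v) a y
    exact this ▸ Submodule.smul_mem _ a hy

theorem span_coord_smulRight_eq_top {V W ι κ : Type*} [AddCommGroup V] [Module ℂ V]
    [AddCommGroup W] [Module ℂ W] [Fintype ι] (b : Module.Basis ι ℂ V) {w : κ → W}
    (hw : Submodule.span ℂ (Set.range w) = ⊤) :
    Submodule.span ℂ (Set.range fun p : ι × κ => (b.coord p.1).smulRight (w p.2)) = ⊤ :=
  span_smulRight_eq_top (w := w) (fun i => b.coord i) b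
    (fun v => by simp only [Module.Basis.coord_apply, b.sum_repr]) hw

theorem span_coord_smulRight_tmul_eq_top {V W X ι κ τ : Type*} [AddCommGroup V] [Module ℂ V]
    [AddCommGroup W] [Module ℂ W] [AddCommGroup X] [Module ℂ X] [Fintype ι]
    (b : Module.Basis ι ℂ V) (c : Module.Basis κ ℂ W) (d : Module.Basis τ ℂ X) :
    Submodule.span ℂ (Set.range fun p : ι × (κ × τ) =>
      (b.coord p.1).smulRight (c p.2.1 ⊗ₜ[ℂ] d p.2.2)) = ⊤ := by
  have hw : Submodule.span ℂ (Set.range fun q : κ × τ => c q.1 ⊗ₜ[ℂ] d q.2) = ⊤ :=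
    span_tmul_range_eq_top (v := c) (w := d) c.span_eq d.span_eq
  exact span_coord_smulRight_eq_top (w := fun q : κ × τ => c q.1 ⊗ₜ[ℂ] d q.2) b hw

/-- **Burnside's theorem**: the operators of an irreducible finite dimensional complex
representation span the endomorphism algebra. -/
theorem span_range_eq_top_of_isIrreducible {G V : Type*} [Group G] [AddCommGroup V] [Module ℂ V]
    [FiniteDimensional ℂ V] (ρ : Representation ℂ G V) (h : ρ.IsIrreducible) :
    Submodule.span ℂ (Set.range fun g => (ρ g : Module.End ℂ V)) = ⊤ := by
  rw [eq_top_iff]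
  rintro T -
  -- By Schur the commutant is ℂ, so every ℂ-linear `T` commutes with it. Jacobson density then
  -- matches `T` on a basis with an element of the group algebra.
  have hS := IsSimpleModule.algebraMap_end_bijective_of_isAlgClosed ℂ
    (A := MonoidAlgebra ℂ G) (V := ρ.asModule)
  let T' : Module.End (Module.End (MonoidAlgebra ℂ G) ρ.asModule) ρ.asModule :=
    { toFun := fun x => ρ.asModuleEquiv.symm (T (ρ.asModuleEquiv x))
      map_add' := by simp
      map_smul' := by
        intro c x
        obtain ⟨a, rfl⟩ := hS.2 c
        simp }
  classical
  obtain ⟨r, hr⟩ := jacobson_density T'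
    (Finset.univ.image fun i => ρ.asModuleEquiv.symm (Module.finBasis ℂ V i))
  have hTr : T = ρ.asAlgebraHom r := by
    refine (Module.finBasis ℂ V).ext fun i => ?_
    have h1 := hr _ (Finset.mem_image_of_mem _ (Finset.mem_univ i))
    have h2 := congrArg ρ.asModuleEquiv h1
    simpa [T'] using h2
  rw [hTr]
  clear hr hTr
  induction r using MonoidAlgebra.induction_linear with
  | zero => simp
  | add f g hf hg => rw [map_add]; exact add_mem hf hg
  | single g a =>
    rw [Representation.asAlgebraHom_single]
    exact Submodule.smul_mem _ _ (Submodule.subset_span ⟨g, rfl⟩)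

/-! ### Invariants of tensor products -/

/-- If a linear function on `End V` is invariant under right translation by the operators `ρ g`,
it does not distinguish operators which agree on the common fixed vectors of the `ρ g`. -/
theorem map_eq_of_eq_on_fixed {V W ι : Type*} [AddCommGroup V] [Module ℂ V]
    [FiniteDimensional ℂ V] [AddCommGroup W] [Module ℂ W] (ρ : ι → Module.End ℂ V)
    (F : Module.End ℂ V →ₗ[ℂ] W) (hF : ∀ Q g, F (Q ∘ₗ ρ g) = F Q) {P P' : Module.End ℂ V}
    (hP : ∀ v, (∀ g, ρ g v = v) → P v = P' v) : F P = F P' := by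
  rw [← sub_eq_zero, ← map_sub]
  set b := Module.finBasis ℂ V
  set R := P - P' with hR
  have hsum : R = ∑ a, (b.coord a ∘ₗ R).smulRight (b a) := by
    ext v
    simp [b.sum_repr]
  rw [hsum, map_sum]
  refine Finset.sum_eq_zero fun a _ => ?_
  -- The common kernel of these functionals is the space of common fixed vectors, where `R`
  -- vanishes. In finite dimension a functional vanishing on a common kernel lies in the span.
  have hmem : b.coord a ∘ₗ R ∈ Submodule.span ℂ
      (Set.range fun p : ι × _ => b.coord p.2 ∘ₗ (ρ p.1 - LinearMap.id)) := by
    refine FiniteDimensional.mem_span_of_iInf_ker_le_ker fun v hv => ?_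
    have hv' : ∀ g, ρ g v = v := fun g => by
      rw [← sub_eq_zero]
      refine b.ext_elem fun c => ?_
      simpa using (Submodule.mem_iInf _).1 hv (g, c)
    simp [hR, hP v hv']
  refine Submodule.span_induction (p := fun ψ _ => F (ψ.smulRight (b a)) = 0) ?_ ?_ ?_ ?_ hmem
  · rintro _ ⟨⟨g, c⟩, rfl⟩
    have : (b.coord c ∘ₗ (ρ g - LinearMap.id)).smulRight (b a) =
        (b.coord c).smulRight (b a) ∘ₗ ρ g - (b.coord c).smulRight (b a) := by
      ext v; simp [sub_smul]
    simp only [this, map_sub, hF, sub_self]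
  · simp
  · intro ψ χ _ _ h1 h2
    have : (ψ + χ).smulRight (b a) = ψ.smulRight (b a) + χ.smulRight (b a) := by
      ext v; simp [add_smul]
    rw [this, map_add, h1, h2, add_zero]
  · intro c ψ _ h1
    have : (c • ψ).smulRight (b a) = c • ψ.smulRight (b a) := by
      ext v; simp [mul_smul]
    rw [this, map_smul, h1, smul_zero]

/-! ### The chain composition -/

theorem chainStep_tmul {A B C P P' : Type*} [AddCommGroup A] [Module ℂ A] [AddCommGroup B]
    [Module ℂ B] [AddCommGroup C] [Module ℂ C] [AddCommGroup P] [Module ℂ P] [AddCommGroup P']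
    [Module ℂ P'] (T : B →ₗ[ℂ] A ⊗[ℂ] C) (c : C ⊗[ℂ] P →ₗ[ℂ] P') (x : B) (p : P) :
    chainStep T c (x ⊗ₜ p) = LinearMap.lTensor A c (TensorProduct.assoc ℂ A C P (T x ⊗ₜ p)) := rfl

theorem chainStep_add_comp {A B C P P' : Type*} [AddCommGroup A] [Module ℂ A] [AddCommGroup B]
    [Module ℂ B] [AddCommGroup C] [Module ℂ C] [AddCommGroup P] [Module ℂ P] [AddCommGroup P']
    [Module ℂ P'] {D : Type*} [AddCommGroup D] [Module ℂ D]
    (T T' : B →ₗ[ℂ] A ⊗[ℂ] C) (c : C ⊗[ℂ] P →ₗ[ℂ] P') (f : D →ₗ[ℂ] B ⊗[ℂ] P) :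
    chainStep (T + T') c ∘ₗ f = chainStep T c ∘ₗ f + chainStep T' c ∘ₗ f := by
  simp [chainStep, LinearMap.rTensor_add, LinearMap.comp_add, LinearMap.add_comp]

theorem chainStep_smul_comp {A B C P P' : Type*} [AddCommGroup A] [Module ℂ A] [AddCommGroup B]
    [Module ℂ B] [AddCommGroup C] [Module ℂ C] [AddCommGroup P] [Module ℂ P] [AddCommGroup P']
    [Module ℂ P'] {D : Type*} [AddCommGroup D] [Module ℂ D]
    (a : ℂ) (T : B →ₗ[ℂ] A ⊗[ℂ] C) (c : C ⊗[ℂ] P →ₗ[ℂ] P') (f : D →ₗ[ℂ] B ⊗[ℂ] P) :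
    chainStep (a • T) c ∘ₗ f = a • chainStep T c ∘ₗ f := by
  simp [chainStep, LinearMap.rTensor_smul, LinearMap.comp_smul, LinearMap.smul_comp]

theorem chainStep_pure {A B C P P' : Type*} [AddCommGroup A] [Module ℂ A] [AddCommGroup B]
    [Module ℂ B] [AddCommGroup C] [Module ℂ C] [AddCommGroup P] [Module ℂ P] [AddCommGroup P']
    [Module ℂ P']
    {T : B →ₗ[ℂ] A ⊗[ℂ] C} (c : C ⊗[ℂ] P →ₗ[ℂ] P') {y : B} {r : ℂ} {x : A} {z : C}
    (hT : T y = r • (x ⊗ₜ z)) (k : ℂ) (p : P) :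
    chainStep T c (k • (y ⊗ₜ p)) = (r * k) • (x ⊗ₜ c (z ⊗ₜ p)) := by
  rw [map_smul, chainStep_tmul, hT, TensorProduct.smul_tmul', TensorProduct.assoc_tmul,
    LinearMap.lTensor_tmul, ← TensorProduct.smul_tmul', smul_smul, mul_comm]

/-- The hypothesis on `T` trades `b` for `a ⊗ s`, and the one on `c` trades `s ⊗ p` for `q`. This is
the induction step of `chainComp_natural`. -/
theorem chainStep_natural {A B C P P' : Type*} [AddCommGroup A] [Module ℂ A] [AddCommGroup B]
    [Module ℂ B] [AddCommGroup C] [Module ℂ C] [AddCommGroup P] [Module ℂ P] [AddCommGroup P']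
    [Module ℂ P']
    {T T' : B →ₗ[ℂ] A ⊗[ℂ] C} {c : C ⊗[ℂ] P →ₗ[ℂ] P'} {a : A →ₗ[ℂ] A} {b : B →ₗ[ℂ] B}
    {s : C →ₗ[ℂ] C} {p : P →ₗ[ℂ] P} {q : P' →ₗ[ℂ] P'}
    (hT : ∀ y, T' (b y) = TensorProduct.map a s (T y))
    (hc : ∀ y z, c (s y ⊗ₜ p z) = q (c (y ⊗ₜ z))) (z : B ⊗[ℂ] P) :
    chainStep T' c (TensorProduct.map b p z) = TensorProduct.map a q (chainStep T c z) := by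
  induction z using TensorProduct.induction_on with
  | zero => simp
  | add z w hz hw => simp only [map_add, hz, hw]
  | tmul y p =>
    rw [TensorProduct.map_tmul, chainStep_tmul, chainStep_tmul, hT]
    generalize T y = w
    induction w using TensorProduct.induction_on with
    | zero => simp
    | add z w hz hw => simp only [map_add, TensorProduct.add_tmul, hz, hw]
    | tmul u v => simp [hc]

theorem chainComp_succ (m : ℕ) (M : Fin (m + 2) → Type u) [∀ i, AddCommGroup (M i)]
    [∀ i, Module ℂ (M i)] (S : Fin (m + 1) → Type v) [∀ j, AddCommGroup (S j)]
    [∀ j, Module ℂ (S j)] (T : ∀ j : Fin (m + 1), M j.succ →ₗ[ℂ] M j.castSucc ⊗[ℂ] S j) :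
    chainComp (m + 1) M S T = chainStep (A := M 0) (C := S 0) (T 0) (tensorCons S) ∘ₗ
      chainComp m (fun i => M i.succ) (fun j => S j.succ) (fun j => T j.succ) := rfl

/-- An update at `0` changes only the outer link and leaves the tail alone; an update at a successor
changes only the tail, which is the induction hypothesis. -/
theorem chainComp_update_add : ∀ (m : ℕ) (M : Fin (m + 1) → Type u) [∀ i, AddCommGroup (M i)]
    [∀ i, Module ℂ (M i)] (S : Fin m → Type v) [∀ j, AddCommGroup (S j)]
    [∀ j, Module ℂ (S j)] (T : ∀ j : Fin m, M j.succ →ₗ[ℂ] M j.castSucc ⊗[ℂ] S j) (j : Fin m)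
    (a b : M j.succ →ₗ[ℂ] M j.castSucc ⊗[ℂ] S j),
    chainComp m M S (Function.update T j (a + b)) =
      chainComp m M S (Function.update T j a) + chainComp m M S (Function.update T j b)
  | 0, _, _, _, _, _, _, _, j, _, _ => j.elim0
  | m + 1, M, _, _, S, _, _, T, j, a, b => by
    have h0 := Fin.tail_update_zero T
    have hs := Fin.tail_update_succ T
    unfold Fin.tail at h0 hs
    simp only [chainComp_succ]
    induction j using Fin.cases with
    | zero =>
      rw [h0, h0, h0]
      simp only [Function.update_self]
      exact chainStep_add_comp _ _ _ _
    | succ k =>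
      rw [hs, hs, hs, chainComp_update_add]
      simp only [Function.update_of_ne (Fin.succ_ne_zero k).symm, LinearMap.comp_add]

theorem chainComp_update_smul : ∀ (m : ℕ) (M : Fin (m + 1) → Type u) [∀ i, AddCommGroup (M i)]
    [∀ i, Module ℂ (M i)] (S : Fin m → Type v) [∀ j, AddCommGroup (S j)]
    [∀ j, Module ℂ (S j)] (T : ∀ j : Fin m, M j.succ →ₗ[ℂ] M j.castSucc ⊗[ℂ] S j) (j : Fin m)
    (c : ℂ) (a : M j.succ →ₗ[ℂ] M j.castSucc ⊗[ℂ] S j),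
    chainComp m M S (Function.update T j (c • a)) = c • chainComp m M S (Function.update T j a)
  | 0, _, _, _, _, _, _, _, j, _, _ => j.elim0
  | m + 1, M, _, _, S, _, _, T, j, c, a => by
    have h0 := Fin.tail_update_zero T
    have hs := Fin.tail_update_succ T
    unfold Fin.tail at h0 hs
    simp only [chainComp_succ]
    induction j using Fin.cases with
    | zero =>
      rw [h0, h0]
      simp only [Function.update_self]
      exact chainStep_smul_comp _ _ _ _
    | succ k =>
      rw [hs, hs, chainComp_update_smul]
      simp only [Function.update_of_ne (Fin.succ_ne_zero k).symm, LinearMap.comp_smul]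

/-- The chain composition as a multilinear map of its factors. -/
def chainMultilinear (m : ℕ) (M : Fin (m + 1) → Type u) [∀ i, AddCommGroup (M i)]
    [∀ i, Module ℂ (M i)] (S : Fin m → Type v) [∀ j, AddCommGroup (S j)] [∀ j, Module ℂ (S j)] :
    MultilinearMap ℂ (fun j : Fin m => M j.succ →ₗ[ℂ] M j.castSucc ⊗[ℂ] S j)
      (M (Fin.last m) →ₗ[ℂ] M 0 ⊗[ℂ] (⨂[ℂ] j, S j)) :=
  MultilinearMap.mk' (chainComp m M S) (chainComp_update_add m M S) (chainComp_update_smul m M S)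

/-- The chain composition on vectors which every factor maps to a multiple of a pure tensor. -/
theorem chainComp_pure : ∀ (m : ℕ) (M : Fin (m + 1) → Type u) [∀ i, AddCommGroup (M i)]
    [∀ i, Module ℂ (M i)] (S : Fin m → Type v) [∀ j, AddCommGroup (S j)]
    [∀ j, Module ℂ (S j)] (T : ∀ j : Fin m, M j.succ →ₗ[ℂ] M j.castSucc ⊗[ℂ] S j)
    (x : ∀ i, M i) (s : ∀ j, S j) (c : Fin m → ℂ)
    (_ : ∀ j, T j (x j.succ) = c j • (x j.castSucc ⊗ₜ s j)),
    chainComp m M S T (x (Fin.last m)) = (∏ j, c j) • (x 0 ⊗ₜ PiTensorProduct.tprod ℂ s)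
  | 0, M, _, _, S, _, _, T, x, s, c, _ => by
    simp only [chainComp, LinearMap.comp_apply, Finset.univ_eq_empty, Finset.prod_empty, one_smul]
    have : (PiTensorProduct.isEmptyEquiv (R := ℂ) (s := S) (Fin 0)).symm 1 =
        PiTensorProduct.tprod ℂ s := by
      rw [LinearEquiv.symm_apply_eq]; simp
    rw [← this]
    rfl
  | m + 1, M, _, _, S, _, _, T, x, s, c, h => by
    have ih := chainComp_pure m (fun i => M i.succ) (fun j => S j.succ) (fun j => T j.succ)
      (fun i => x i.succ) (fun j => s j.succ) (fun j => c j.succ) (fun j => h j.succ)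
    -- The successor of `Fin.last m` is `Fin.last (m + 1)` by definition, so `ih` already concerns
    -- the last vector of the longer chain.
    have ih' : chainComp m (fun i => M i.succ) (fun j => S j.succ) (fun j => T j.succ)
      (x (Fin.last (m + 1))) = _ := ih
    have hc : (Fin.cons (s 0) fun j => s j.succ : ∀ j, S j) = s := Fin.cons_self_tail s
    rw [chainComp_succ, LinearMap.comp_apply, ih']
    refine (chainStep_pure (tensorCons S) (h 0) _ _).trans ?_
    rw [tensorCons_tmul_tprod, hc, Fin.prod_univ_succ]
    rfl

theorem tensorCons_map {m : ℕ} (S : Fin (m + 1) → Type*) [∀ j, AddCommGroup (S j)]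
    [∀ j, Module ℂ (S j)] (s : ∀ j, S j →ₗ[ℂ] S j) (y : S 0)
    (p : ⨂[ℂ] j : Fin m, S j.succ) :
    tensorCons S (s 0 y ⊗ₜ PiTensorProduct.map (fun j => s j.succ) p) =
      PiTensorProduct.map s (tensorCons S (y ⊗ₜ p)) := by
  induction p using PiTensorProduct.induction_on with
  | smul_tprod r z =>
    simp only [map_smul, TensorProduct.tmul_smul, PiTensorProduct.map_tprod, tensorCons_tmul_tprod]
    congr 2
    funext j
    induction j using Fin.cases <;> rfl
  | add p q hp hq => simp only [map_add, TensorProduct.tmul_add, hp, hq]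

/-- Naturality of the chain composition. -/
theorem chainComp_natural : ∀ (m : ℕ) (M : Fin (m + 1) → Type u) [∀ i, AddCommGroup (M i)]
    [∀ i, Module ℂ (M i)] (S : Fin m → Type v) [∀ j, AddCommGroup (S j)]
    [∀ j, Module ℂ (S j)] (T T' : ∀ j : Fin m, M j.succ →ₗ[ℂ] M j.castSucc ⊗[ℂ] S j)
    (a : ∀ i, M i →ₗ[ℂ] M i) (s : ∀ j, S j →ₗ[ℂ] S j)
    (_ : ∀ j x, T' j (a j.succ x) = TensorProduct.map (a j.castSucc) (s j) (T j x))
    (x : M (Fin.last m)),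
    chainComp m M S T' (a (Fin.last m) x) =
      TensorProduct.map (a 0) (PiTensorProduct.map s) (chainComp m M S T x)
  | 0, M, _, _, S, _, _, T, T', a, s, _, x => by
    have : (PiTensorProduct.isEmptyEquiv (R := ℂ) (s := S) (Fin 0)).symm 1 =
        PiTensorProduct.tprod ℂ (fun j => j.elim0) := by
      rw [LinearEquiv.symm_apply_eq]; simp
    have h : ∀ (y : M 0), chainComp 0 M S T' y =
        y ⊗ₜ PiTensorProduct.tprod ℂ (fun j => j.elim0) := fun y => this ▸ rfl
    have h' : ∀ (y : M 0), chainComp 0 M S T y =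
        y ⊗ₜ PiTensorProduct.tprod ℂ (fun j => j.elim0) := fun y => this ▸ rfl
    refine (h _).trans ((congrArg _ (h' _)).trans ?_).symm
    rw [TensorProduct.map_tmul, PiTensorProduct.map_tprod]
    congr 2
    funext j
    exact j.elim0
  | m + 1, M, _, _, S, _, _, T, T', a, s, h, x => by
    have ih := chainComp_natural m (fun i => M i.succ) (fun j => S j.succ) (fun j => T j.succ)
      (fun j => T' j.succ) (fun i => a i.succ) (fun j => s j.succ) (fun j => h j.succ) x
    exact (congrArg _ ih).trans (chainStep_natural (h 0) (tensorCons_map S s) _)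

/-! ### The map `Q` -/

/-- Moving the scalars into the right factor reassembles `n` from its coordinates. Rank one maps
span, so this value determines `Q`. -/
theorem spinQ_smulRight {X N : Type*} [AddCommGroup X] [Module ℂ X] [AddCommGroup N] [Module ℂ N]
    [FiniteDimensional ℂ N] (n : N) (x : X) :
    spinQ ((Module.Dual.eval ℂ N n).smulRight x) = x ⊗ₜ n := by
  simp only [spinQ, LinearMap.smulRight_apply, Module.Dual.eval_apply, TensorProduct.smul_tmul,
    ← TensorProduct.tmul_sum, Module.Basis.coord_apply, Module.Basis.sum_repr]

/-- `Q` as a linear map. -/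
def spinQLinear (X N : Type*) [AddCommGroup X] [Module ℂ X] [AddCommGroup N] [Module ℂ N]
    [FiniteDimensional ℂ N] : (Module.Dual ℂ N →ₗ[ℂ] X) →ₗ[ℂ] X ⊗[ℂ] N where
  toFun := spinQ
  map_add' T T' := by simp [spinQ, TensorProduct.add_tmul, Finset.sum_add_distrib]
  map_smul' a T := by simp [spinQ, TensorProduct.smul_tmul', Finset.smul_sum]

theorem spinQ_comp {X Y N : Type*} [AddCommGroup X] [Module ℂ X] [AddCommGroup Y] [Module ℂ Y]
    [AddCommGroup N] [Module ℂ N] [FiniteDimensional ℂ N] (f : X →ₗ[ℂ] Y)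
    (T : Module.Dual ℂ N →ₗ[ℂ] X) (ν : N →ₗ[ℂ] N) :
    spinQ (f ∘ₗ T ∘ₗ ν.dualMap) = TensorProduct.map f ν (spinQ T) := by
  -- Splitting `T` into rank one maps reduces the claim to `spinQ_smulRight`: the transpose of `ν`
  -- turns evaluation at n into evaluation at ν n.
  have hsum : T = ∑ i, (Module.Dual.eval ℂ N (Module.finBasis ℂ N i)).smulRight
      (T ((Module.finBasis ℂ N).coord i)) := by
    ext ψ
    have : ψ = ∑ i, ψ (Module.finBasis ℂ N i) • (Module.finBasis ℂ N).coord i :=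
      (Module.finBasis ℂ N).ext fun i => by simp
    conv_lhs => rw [this, map_sum]
    simp
  have hcomp : f ∘ₗ T ∘ₗ ν.dualMap = ∑ i,
      (Module.Dual.eval ℂ N (ν (Module.finBasis ℂ N i))).smulRight
        (f (T ((Module.finBasis ℂ N).coord i))) := by
    conv_lhs => rw [hsum]
    ext ψ
    simp
  rw [hcomp]
  change spinQLinear Y N _ = _
  rw [map_sum]
  change ∑ i, spinQ _ = _
  simp only [spinQ_smulRight]
  simp [spinQ]

/-! ### The linear map underlying the spherical functions -/

section SphericalMap

variable {G : Type*} [Group G] {m : ℕ}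
  {M : Fin (m + 1) → Type u} [∀ i, AddCommGroup (M i)] [∀ i, Module ℂ (M i)]
  (π : ∀ i, Representation ℂ G (M i))
  (L : Type*) [AddCommGroup L] [Module ℂ L]
  (S : Fin m → Type v) [∀ j, AddCommGroup (S j)] [∀ j, Module ℂ (S j)]
  (N : Type*) [AddCommGroup N] [Module ℂ N]

/-- The space `Hom(M 0, L) ⊗ ⨂ j, Hom(M (j + 1), M j ⊗ S j) ⊗ Hom(N^*, M m)` of all decorations of
the vertices of the linear graph, with no equivariance imposed. -/
abbrev Decorations (M : Fin (m + 1) → Type u) [∀ i, AddCommGroup (M i)] [∀ i, Module ℂ (M i)]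
    (L : Type*) [AddCommGroup L] [Module ℂ L]
    (S : Fin m → Type v) [∀ j, AddCommGroup (S j)] [∀ j, Module ℂ (S j)]
    (N : Type*) [AddCommGroup N] [Module ℂ N] : Type _ :=
  ((M 0 →ₗ[ℂ] L) ⊗[ℂ] (⨂[ℂ] j : Fin m, M j.succ →ₗ[ℂ] M j.castSucc ⊗[ℂ] S j)) ⊗[ℂ]
    (Module.Dual ℂ N →ₗ[ℂ] M (Fin.last m))

/-- The contraction of the outer decorations with the chain of the inner ones. -/
def contract (X : Type*) [AddCommGroup X] [Module ℂ X] {A B L N : Type*} [AddCommGroup A]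
    [Module ℂ A] [AddCommGroup B] [Module ℂ B] [AddCommGroup L] [Module ℂ L] [AddCommGroup N]
    [Module ℂ N] [FiniteDimensional ℂ N] :
    (A →ₗ[ℂ] L) →ₗ[ℂ] (B →ₗ[ℂ] A ⊗[ℂ] X) →ₗ[ℂ]
      (Module.Dual ℂ N →ₗ[ℂ] B) →ₗ[ℂ] (L ⊗[ℂ] X) ⊗[ℂ] N :=
  LinearMap.mk₂ ℂ (fun Θ C => spinQLinear (L ⊗[ℂ] X) N ∘ₗ
      LinearMap.llcomp ℂ (Module.Dual ℂ N) B (L ⊗[ℂ] X) (LinearMap.rTensor X Θ ∘ₗ C))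
    (fun Θ Θ' C => by simp [LinearMap.rTensor_add, LinearMap.add_comp, LinearMap.comp_add])
    (fun a Θ C => by simp [LinearMap.rTensor_smul, LinearMap.smul_comp, LinearMap.comp_smul])
    (fun Θ C C' => by simp [LinearMap.comp_add])
    (fun a Θ C => by simp [LinearMap.comp_smul])

variable {N} [FiniteDimensional ℂ N] {L S}

/-- The value at `g` of the spherical function, as a linear function of the decorations. -/
def sphericalMapAt (g : Fin (m + 1) → G) :
    Decorations M L S N →ₗ[ℂ] (L ⊗[ℂ] (⨂[ℂ] j, S j)) ⊗[ℂ] N :=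
  TensorProduct.lift <| TensorProduct.lift <|
    ((contract (⨂[ℂ] j, S j)).comp (LinearMap.lcomp ℂ L (π 0 (g 0)))).compl₂
      (PiTensorProduct.lift ((chainMultilinear m M S).compLinearMap
        fun j => LinearMap.lcomp ℂ (M j.castSucc ⊗[ℂ] S j) (π j.succ (g j.succ))))

theorem sphericalMapAt_tmul (g : Fin (m + 1) → G) (Θ : M 0 →ₗ[ℂ] L)
    (Φ : ∀ j : Fin m, M j.succ →ₗ[ℂ] M j.castSucc ⊗[ℂ] S j)
    (Ξ : Module.Dual ℂ N →ₗ[ℂ] M (Fin.last m)) :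
    sphericalMapAt π g ((Θ ⊗ₜ PiTensorProduct.tprod ℂ Φ) ⊗ₜ Ξ) =
      sphericalFunction π Θ Φ Ξ g := by
  simp only [sphericalMapAt, TensorProduct.lift.tmul, LinearMap.compl₂_apply,
    PiTensorProduct.lift.tprod]
  rfl

/-- The linear map from decorations to functions underlying the spherical functions. -/
def sphericalMap :
    Decorations M L S N →ₗ[ℂ] ((Fin (m + 1) → G) → (L ⊗[ℂ] (⨂[ℂ] j, S j)) ⊗[ℂ] N) :=
  LinearMap.pi (sphericalMapAt π)

/-- The decoration by rank one maps. -/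
def rankOne (φ : ∀ i, Module.Dual ℂ (M i)) (x : ∀ i, M i) (l : L) (s : ∀ j, S j) (n : N) :
    Decorations M L S N :=
  ((φ 0).smulRight l ⊗ₜ PiTensorProduct.tprod ℂ
    (fun j : Fin m => (φ j.succ).smulRight (x j.castSucc ⊗ₜ[ℂ] s j))) ⊗ₜ
    (Module.Dual.eval ℂ N n).smulRight (x (Fin.last m))

/-- Each link sends its input to a multiple of a pure tensor, so `chainComp_pure` applies. For the
edge `i`, the covector `φ i` sits at the source vertex and the vector `x i` at the target; together
they give one matrix coefficient of `π i`. -/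
theorem sphericalMap_rankOne (φ : ∀ i, Module.Dual ℂ (M i)) (x : ∀ i, M i) (l : L) (s : ∀ j, S j)
    (n : N) (g : Fin (m + 1) → G) :
    sphericalMap π (rankOne φ x l s n) g =
      (∏ i, φ i (π i (g i) (x i))) • ((l ⊗ₜ PiTensorProduct.tprod ℂ s) ⊗ₜ n) := by
  rw [sphericalMap, LinearMap.pi_apply, rankOne, sphericalMapAt_tmul, sphericalFunction]
  have hC := chainComp_pure m M S
    (fun j => (φ j.succ).smulRight (x j.castSucc ⊗ₜ[ℂ] s j) ∘ₗ π j.succ (g j.succ)) x s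
    (fun j => φ j.succ (π j.succ (g j.succ) (x j.succ))) (fun j => rfl)
  have : LinearMap.rTensor (⨂[ℂ] j, S j) ((φ 0).smulRight l ∘ₗ π 0 (g 0)) ∘ₗ
      chainComp m M S
        (fun j => (φ j.succ).smulRight (x j.castSucc ⊗ₜ[ℂ] s j) ∘ₗ π j.succ (g j.succ)) ∘ₗ
        (Module.Dual.eval ℂ N n).smulRight (x (Fin.last m)) =
      (Module.Dual.eval ℂ N n).smulRight
        ((∏ i, φ i (π i (g i) (x i))) • (l ⊗ₜ PiTensorProduct.tprod ℂ s)) := by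
    ext ψ
    simp only [LinearMap.comp_apply, LinearMap.smulRight_apply, map_smul, hC,
      LinearMap.rTensor_tmul, Fin.prod_univ_succ]
    rw [← TensorProduct.smul_tmul', mul_comm (φ 0 _), smul_smul, smul_smul, smul_smul,
      mul_assoc]
  rw [this, spinQ_smulRight, ← TensorProduct.smul_tmul']

/-! ### Rank one decorations built from bases: spanning and independence. -/

section Bases

variable {κ : Fin (m + 1) → Type*} [∀ i, Fintype (κ i)] (b : ∀ i, Module.Basis (κ i) ℂ (M i))
  {ι τ' : Type*} {τ : Fin m → Type*} [∀ j, Fintype (τ j)]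
  (bL : Module.Basis ι ℂ L) (bS : ∀ j, Module.Basis (τ j) ℂ (S j))
  [Fintype τ'] (bN : Module.Basis τ' ℂ N)

/-- The rank one decorations built from bases. -/
def rankOneBasis (p : ((∀ i, κ i) × (∀ i, κ i)) × (ι × (∀ j, τ j)) × τ') : Decorations M L S N :=
  rankOne (fun i => (b i).coord (p.1.1 i)) (fun i => b i (p.1.2 i)) (bL p.2.1.1)
    (fun j => bS j (p.2.1.2 j)) (bN p.2.2)

omit [FiniteDimensional ℂ N] [∀ j, Fintype (τ j)] in
theorem span_rankOneBasis : Submodule.span ℂ (Set.range (rankOneBasis b bL bS bN)) = ⊤ := by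
  classical
  let vΘ : κ 0 × ι → (M 0 →ₗ[ℂ] L) := fun p => ((b 0).coord p.1).smulRight (bL p.2)
  let vΦ : ∀ j : Fin m, κ j.succ × (κ j.castSucc × τ j) →
      (M j.succ →ₗ[ℂ] M j.castSucc ⊗[ℂ] S j) := fun j q =>
    ((b j.succ).coord q.1).smulRight (b j.castSucc q.2.1 ⊗ₜ[ℂ] bS j q.2.2)
  let vΞ : τ' × κ (Fin.last m) → (Module.Dual ℂ N →ₗ[ℂ] M (Fin.last m)) := fun p =>
    (Module.Dual.eval ℂ N (bN p.1)).smulRight (b (Fin.last m) p.2)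
  have hΘ : Submodule.span ℂ (Set.range vΘ) = ⊤ :=
    span_coord_smulRight_eq_top (w := bL) (b 0) bL.span_eq
  have hΦ : Submodule.span ℂ (Set.range fun q : (∀ j, κ j.succ × (κ j.castSucc × τ j)) =>
      PiTensorProduct.tprod ℂ fun j => vΦ j (q j)) = ⊤ :=
    PiTensorProduct.submodule_span_eq_top (g := vΦ)
      fun j => span_coord_smulRight_tmul_eq_top (b j.succ) (b j.castSucc) (bS j)
  have hψ : ∀ ψ : Module.Dual ℂ N, ∑ k, Module.Dual.eval ℂ N (bN k) ψ • bN.coord k = ψ := by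
    intro ψ
    refine bN.ext fun i => ?_
    simp
  have hΞ : Submodule.span ℂ (Set.range vΞ) = ⊤ :=
    span_smulRight_eq_top (w := b (Fin.last m)) _ _ hψ (b (Fin.last m)).span_eq
  have hΘΦ := span_tmul_range_eq_top hΘ hΦ
  have hD := span_tmul_range_eq_top hΘΦ hΞ
  rw [eq_top_iff, ← hD]
  refine Submodule.span_mono ?_
  rintro _ ⟨⟨⟨⟨a, l⟩, q⟩, ⟨n, c⟩⟩, rfl⟩
  -- Reindexing from vertices to edges: the covectors sit at the vertices `0, …, m`, hence
  -- `Fin.cons`, and the vectors at `1, …, m + 1`, hence `Fin.snoc`.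
  refine ⟨((Fin.cons a fun j => (q j).1,
    Fin.snoc (α := κ) (fun j : Fin m => (q j).2.1) c), (l, fun j => (q j).2.2), n), ?_⟩
  simp [rankOneBasis, rankOne, vΘ, vΦ, vΞ]

/-- The family of functions attached to the rank one decorations is linearly independent. -/
theorem linearIndependent_sphericalMap_rankOneBasis [Fintype ι]
    (hπ : ∀ i, Submodule.span ℂ (Set.range fun g => (π i g : Module.End ℂ (M i))) = ⊤) :
    LinearIndependent ℂ fun p => sphericalMap π (rankOneBasis b bL bS bN p) := by
  classical
  rw [Fintype.linearIndependent_iff]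
  intro d hd
  let B := (bL.tensorProduct (Basis.piTensorProduct bS)).tensorProduct bN
  let coeff (a b' : ∀ i, κ i) :
      MultilinearMap ℂ (fun i => Module.End ℂ (M i)) ℂ :=
    (MultilinearMap.mkPiAlgebra ℂ (Fin (m + 1)) ℂ).compLinearMap
      fun i => (b i).coord (a i) ∘ₗ LinearMap.applyₗ (b i (b' i))
  -- The linear relation, extended from tuples of group elements to a multilinear map on tuples of
  -- endomorphisms. It vanishes on the tuples (π_i(g_i)), which span in each slot, so it is zero.
  let A : MultilinearMap ℂ (fun i => Module.End ℂ (M i)) ((L ⊗[ℂ] (⨂[ℂ] j, S j)) ⊗[ℂ] N) :=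
    ∑ p, d p • (coeff p.1.1 p.1.2).smulRight (B p.2)
  have hA : ∀ E, A E = ∑ p, d p • (∏ i, (b i).coord (p.1.1 i) (E i (b i (p.1.2 i)))) • B p.2 := by
    intro E
    simp [A, coeff]
  have hA0 : A = 0 := by
    refine MultilinearMap.ext_of_span_eq_top (g := fun i (g : G) => π i g) hπ fun g => ?_
    have := congrFun hd g
    rw [hA]
    have hB : ∀ r, B r = (bL r.1.1 ⊗ₜ PiTensorProduct.tprod ℂ fun j => bS j (r.1.2 j)) ⊗ₜ bN r.2 :=
      fun r => by simp [B, Module.Basis.tensorProduct_apply']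
    simpa only [sphericalMap_rankOne, rankOneBasis, hB, Finset.sum_apply, Pi.smul_apply,
      Pi.zero_apply, zero_apply] using this
  rintro ⟨⟨α, β⟩, r⟩
  -- Evaluation at the matrix units taking basis vector β_i to α_i leaves only the terms with index
  -- pair (α, β).
  have h := hA fun i => ((b i).coord (β i)).smulRight (b i (α i))
  rw [hA0] at h
  have hprod : ∀ p : (∀ i, κ i) × (∀ i, κ i),
      (∏ i, (b i).coord (p.1 i) (((b i).coord (β i)).smulRight (b i (α i)) (b i (p.2 i)))) =
        if p = (α, β) then 1 else 0 := by
    rintro ⟨a, b'⟩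
    simp only [LinearMap.smulRight_apply, Module.Basis.coord_apply, Module.Basis.repr_self, map_smul,
      smul_eq_mul, Finsupp.single_apply, ← ite_and, mul_ite, mul_one, mul_zero,
      Fintype.prod_ite_zero, Finset.prod_const_one, Prod.mk.injEq, funext_iff, forall_and]
    congr 1
    exact propext ⟨fun h => ⟨fun i => (h.1 i).symm, h.2⟩, fun h => ⟨fun i => (h.1 i).symm, h.2⟩⟩
  simp only [hprod, ite_smul, one_smul, zero_smul, smul_ite, smul_zero,
    zero_apply] at h
  rw [Fintype.sum_prod_type_right] at h
  simp only [Finset.sum_ite_eq', Finset.mem_univ, if_true] at h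
  exact Fintype.linearIndependent_iff.1 B.linearIndependent (fun r => d ((α, β), r)) h.symm r

end Bases

theorem sphericalMap_injective [∀ i, FiniteDimensional ℂ (M i)] [FiniteDimensional ℂ L]
    [∀ j, FiniteDimensional ℂ (S j)]
    (hπ : ∀ i, Submodule.span ℂ (Set.range fun g => (π i g : Module.End ℂ (M i))) = ⊤) :
    Function.Injective (sphericalMap π : Decorations M L S N →ₗ[ℂ] _) := by
  let b := fun i => Module.finBasis ℂ (M i)
  let bL := Module.finBasis ℂ L
  let bS := fun j => Module.finBasis ℂ (S j)
  let bN := Module.finBasis ℂ N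
  have h1 := span_rankOneBasis b bL bS bN
  have h2 := linearIndependent_sphericalMap_rankOneBasis π b bL bS bN hπ
  have h3 := injective_of_span_eq_top (sphericalMap π) (rankOneBasis b bL bS bN) h1 h2
  exact h3


/-- The spherical functions span the functions with values in `𝐒` and coefficients in `R^π`. -/
theorem range_sphericalMap [TopologicalSpace G] [∀ i, FiniteDimensional ℂ (M i)]
    [FiniteDimensional ℂ L] [∀ j, FiniteDimensional ℂ (S j)] (hπ : ∀ i, IsContinuousRep (π i)) :
    LinearMap.range (sphericalMap π : Decorations M L S N →ₗ[ℂ] _) =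
      spinValued (repFunctions (piTensorRep π)) ((L ⊗[ℂ] (⨂[ℂ] j, S j)) ⊗[ℂ] N) := by
  classical
  let b := fun i => Module.finBasis ℂ (M i)
  apply le_antisymm
  · rw [LinearMap.range_eq_map, ← span_rankOneBasis b (Module.finBasis ℂ L)
      (fun j => Module.finBasis ℂ (S j)) (Module.finBasis ℂ N), Submodule.map_span,
      Submodule.span_le]
    rintro _ ⟨_, ⟨p, rfl⟩, rfl⟩
    -- A product of coefficients of the π_i is a single coefficient of their tensor product, taken
    -- between tensor basis elements.
    refine Submodule.subset_span ⟨⟨fun g => ∏ i, (b i).coord (p.1.1 i) (π i (g i) (b i (p.1.2 i))),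
      continuous_finsetProd _ fun i _ => (hπ i _ _).comp (continuous_apply i)⟩,
      Submodule.subset_span ⟨(Basis.piTensorProduct b).coord p.1.1,
        PiTensorProduct.tprod ℂ fun i => b i (p.1.2 i), fun g => ?_⟩, _,
      funext fun g => sphericalMap_rankOne π _ _ _ _ _ g⟩
    simp [piTensorRep]
  · have hle : ∀ (φ : Module.Dual ℂ (⨂[ℂ] i, M i)) (x : ⨂[ℂ] i, M i)
        (w : (L ⊗[ℂ] (⨂[ℂ] j, S j)) ⊗[ℂ] N), (fun g => φ (piTensorRep π g x) • w) ∈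
          LinearMap.range (sphericalMap π : Decorations M L S N →ₗ[ℂ] _) := by
      intro φ x w
      let B := ((Module.finBasis ℂ L).tensorProduct
        (Basis.piTensorProduct fun j => Module.finBasis ℂ (S j))).tensorProduct
        (Module.finBasis ℂ N)
      let E := Basis.piTensorProduct b
      -- Expanding `φ`, `x` and `w` in tensor product bases writes an arbitrary coefficient times a
      -- vector as a combination of the functions of rank one decorations.
      have hfun : (fun g => φ (piTensorRep π g x) • w) =
          ∑ a, ∑ c, ∑ r, (φ (E a) * E.repr x c * B.repr w r) •
            sphericalMap π (rankOneBasis b (Module.finBasis ℂ L)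
              (fun j => Module.finBasis ℂ (S j)) (Module.finBasis ℂ N) ((a, c), r)) := by
        funext g
        have hφ : ∀ y, φ y = ∑ a, φ (E a) * E.repr y a := fun y => by
          conv_lhs => rw [← E.sum_repr y, map_sum]
          simp [mul_comm]
        have hx : ∀ a, E.repr (piTensorRep π g x) a =
            ∑ c, E.repr x c * ∏ i, (b i).coord (a i) (π i (g i) (b i (c i))) := fun a => by
          conv_lhs => rw [← E.sum_repr x]
          simp [E, piTensorRep]
        have hφx : φ (piTensorRep π g x) = ∑ a, ∑ c, φ (E a) *
            (E.repr x c * ∏ i, (b i).coord (a i) (π i (g i) (b i (c i)))) := by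
          simp only [hφ (piTensorRep π g x), hx, Finset.mul_sum]
        conv_lhs => rw [hφx, ← B.sum_repr w]
        simp only [Finset.sum_apply, Pi.smul_apply, rankOneBasis, sphericalMap_rankOne,
          Finset.sum_smul]
        simp only [Finset.smul_sum, smul_smul]
        refine Finset.sum_congr rfl fun a _ => Finset.sum_congr rfl fun c _ =>
          Finset.sum_congr rfl fun r _ => ?_
        have hB : B r = (Module.finBasis ℂ L r.1.1 ⊗ₜ PiTensorProduct.tprod ℂ
          fun j => Module.finBasis ℂ (S j) (r.1.2 j)) ⊗ₜ Module.finBasis ℂ N r.2 := by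
          simp [B, Module.Basis.tensorProduct_apply']
        rw [hB]
        congr 1
        ring
      rw [hfun]
      exact Submodule.sum_mem _ fun a _ => Submodule.sum_mem _ fun c _ =>
        Submodule.sum_mem _ fun r _ => Submodule.smul_mem _ _ ⟨_, rfl⟩
    rw [spinValued, Submodule.span_le]
    rintro _ ⟨c, hc, w, rfl⟩
    refine Submodule.span_induction (p := fun (c : C(Fin (m + 1) → G, ℂ)) _ =>
      (fun g => c g • w) ∈ LinearMap.range
        (sphericalMap π : Decorations M L S N →ₗ[ℂ] _)) ?_ ?_ ?_ ?_ hc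
    · rintro c ⟨φ, x, hc⟩
      simpa only [hc] using hle φ x w
    · refine ⟨0, ?_⟩
      simp only [map_zero, ContinuousMap.zero_apply, zero_smul]
      rfl
    · intro c d _ _ h1 h2
      simpa [add_smul] using! add_mem h1 h2
    · intro a c _ h1
      simpa [mul_smul] using! Submodule.smul_mem _ a h1

end SphericalMap

/-! ### Fixed vectors of tensor products -/

section Fixed

variable {V₀ W₀ V₁ W₁ : Type*} [AddCommGroup V₀] [Module ℂ V₀] [FiniteDimensional ℂ V₀]
  [AddCommGroup W₀] [Module ℂ W₀] [AddCommGroup V₁] [Module ℂ V₁] [FiniteDimensional ℂ V₁]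
  [AddCommGroup W₁] [Module ℂ W₁] {m : ℕ}
  {V W : Fin m → Type*} [∀ j, AddCommGroup (V j)] [∀ j, Module ℂ (V j)]
  [∀ j, FiniteDimensional ℂ (V j)] [∀ j, AddCommGroup (W j)] [∀ j, Module ℂ (W j)]

omit [∀ j, FiniteDimensional ℂ (V j)] in
/-- A vector fixed by the operators which act by `p j` in the slot `j` is fixed by `⨂ j, p j`. -/
theorem map_piTensor_eq_of_update {T : Type*} [AddCommMonoid T] [Module ℂ T]
    (α : Module.End ℂ (⨂[ℂ] j, V j) →* Module.End ℂ T) (p : ∀ j, Module.End ℂ (V j)) {t : T}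
    (h : ∀ j, α (PiTensorProduct.map (Function.update (fun j => (1 : Module.End ℂ (V j))) j (p j)))
      t = t) : α (PiTensorProduct.map p) t = t := by
  classical
  -- Induction on the set of slots where `p` acts; each new slot multiplies by one operator already
  -- known to fix `t`.
  suffices ∀ s : Finset (Fin m), α (PiTensorProduct.map fun j => if j ∈ s then p j else 1) t = t by
    simpa using this Finset.univ
  intro s
  induction s using Finset.induction_on with
  | empty =>
    have h1 : (PiTensorProduct.map fun j => (1 : Module.End ℂ (V j))) = 1 :=
      PiTensorProduct.map_one
    simp [h1]
  | insert a s ha ih =>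
    have : (fun j => if j ∈ insert a s then p j else 1) = fun j =>
        Function.update (fun j => (1 : Module.End ℂ (V j))) a (p a) j *
          (if j ∈ s then p j else 1) := by
      funext j
      by_cases hj : j = a
      · subst hj; simp [ha]
      · simp [hj]
    rw [this, PiTensorProduct.map_mul, map_mul, Module.End.mul_apply, ih, h]

/-- If a linear representation of the monoid `End V` on `T` is given, a vector of `T` fixed by
the operators `ρ g` is fixed by every operator `P` which is the identity on the vectors fixed by
all `ρ g`. -/
theorem fixed_of_fixed {V T ι : Type*} [AddCommGroup V] [Module ℂ V] [FiniteDimensional ℂ V]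
    [AddCommGroup T] [Module ℂ T] (α : Module.End ℂ V →ₗ[ℂ] Module.End ℂ T)
    (hmul : ∀ P Q, α (P * Q) = α P * α Q) (hone : α 1 = 1) (ρ : ι → Module.End ℂ V) {t : T}
    (ht : ∀ g, α (ρ g) t = t) (P : Module.End ℂ V) (hP : ∀ v, (∀ g, ρ g v = v) → P v = v) :
    α P t = t := by
  have := map_eq_of_eq_on_fixed ρ ((LinearMap.applyₗ t).comp α)
    (fun Q g => by
      change α (Q * ρ g) t = α Q t
      rw [hmul, Module.End.mul_apply, ht]) (P := P) (P' := 1) hP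
  simpa [hone] using this

/-- The fixed vectors of a product action on a tensor product are the tensors of fixed vectors. -/
theorem mem_range_map_of_fixed {ι₀ ι₁ : Type*} {ι : Fin m → Type*} (ρ₀ : ι₀ → Module.End ℂ V₀)
    (ρ : ∀ j, ι j → Module.End ℂ (V j)) (ρ₁ : ι₁ → Module.End ℂ V₁)
    (i₀ : W₀ →ₗ[ℂ] V₀) (i : ∀ j, W j →ₗ[ℂ] V j) (i₁ : W₁ →ₗ[ℂ] V₁)
    (r₀ : V₀ →ₗ[ℂ] W₀) (r : ∀ j, V j →ₗ[ℂ] W j) (r₁ : V₁ →ₗ[ℂ] W₁)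
    (h₀ : ∀ v, (∀ g, ρ₀ g v = v) → i₀ (r₀ v) = v)
    (h : ∀ j v, (∀ g, ρ j g v = v) → i j (r j v) = v)
    (h₁ : ∀ v, (∀ g, ρ₁ g v = v) → i₁ (r₁ v) = v)
    {t : (V₀ ⊗[ℂ] (⨂[ℂ] j, V j)) ⊗[ℂ] V₁}
    (ht₀ : ∀ g, TensorProduct.map (TensorProduct.map (ρ₀ g) LinearMap.id) LinearMap.id t = t)
    (ht : ∀ j g, TensorProduct.map (TensorProduct.map LinearMap.id (PiTensorProduct.map
      (Function.update (fun j => (1 : Module.End ℂ (V j))) j (ρ j g)))) LinearMap.id t = t)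
    (ht₁ : ∀ g, TensorProduct.map (TensorProduct.map LinearMap.id LinearMap.id) (ρ₁ g) t = t) :
    t ∈ LinearMap.range
      (TensorProduct.map (TensorProduct.map i₀ (PiTensorProduct.map i)) i₁) := by
  let T := (V₀ ⊗[ℂ] (⨂[ℂ] j, V j)) ⊗[ℂ] V₁
  let β : Module.End ℂ (⨂[ℂ] j, V j) →* Module.End ℂ T :=
    { toFun := fun X => TensorProduct.map (TensorProduct.map LinearMap.id X) LinearMap.id
      map_one' := by ext; simp
      map_mul' := fun X Y => by
        rw [Module.End.mul_eq_comp, Module.End.mul_eq_comp, ← TensorProduct.map_comp,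
          ← TensorProduct.map_comp]
        rfl }
  -- The operator `i₀ ∘ₗ r₀` need not commute with the action: being the identity on fixed vectors
  -- is all that `fixed_of_fixed` asks.
  have e₀ : TensorProduct.map (TensorProduct.map (i₀ ∘ₗ r₀) LinearMap.id) LinearMap.id t = t :=
    fixed_of_fixed
      { toFun := fun X => (TensorProduct.map (TensorProduct.map X LinearMap.id) LinearMap.id :
          Module.End ℂ T)
        map_add' := fun X Y => by rw [TensorProduct.map_add_left, TensorProduct.map_add_left]
        map_smul' := fun a X => by rw [TensorProduct.map_smul_left, TensorProduct.map_smul_left]; rfl }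
      (fun X Y => by
        change TensorProduct.map _ _ = TensorProduct.map _ _ ∘ₗ TensorProduct.map _ _
        rw [← TensorProduct.map_comp, ← TensorProduct.map_comp]
        rfl)
      (by
        change TensorProduct.map (TensorProduct.map LinearMap.id LinearMap.id) LinearMap.id = _
        rw [TensorProduct.map_id, TensorProduct.map_id]; rfl)
      ρ₀ ht₀ _ h₀
  have e₁ : TensorProduct.map (TensorProduct.map LinearMap.id LinearMap.id) (i₁ ∘ₗ r₁) t = t :=
    fixed_of_fixed
      { toFun := fun X => (TensorProduct.map (TensorProduct.map LinearMap.id LinearMap.id) X :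
          Module.End ℂ T)
        map_add' := fun X Y => by rw [TensorProduct.map_add_right]
        map_smul' := fun a X => by rw [TensorProduct.map_smul_right]; rfl }
      (fun X Y => by
        change TensorProduct.map _ _ = TensorProduct.map _ _ ∘ₗ TensorProduct.map _ _
        rw [← TensorProduct.map_comp, ← TensorProduct.map_comp]
        rfl)
      (by
        change TensorProduct.map (TensorProduct.map LinearMap.id LinearMap.id) LinearMap.id = _
        rw [TensorProduct.map_id, TensorProduct.map_id]; rfl)
      ρ₁ ht₁ _ h₁
  have e : β (PiTensorProduct.map fun j => i j ∘ₗ r j) t = t := by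
    refine map_piTensor_eq_of_update β _ fun j => ?_
    refine fixed_of_fixed
      { toFun := fun X => β (PiTensorProduct.map
          (Function.update (fun j => (1 : Module.End ℂ (V j))) j X))
        map_add' := fun X Y => by
          change TensorProduct.map _ _ = TensorProduct.map _ _ + TensorProduct.map _ _
          rw [PiTensorProduct.map_update_add, TensorProduct.map_add_right,
            TensorProduct.map_add_left]
        map_smul' := fun a X => by
          change TensorProduct.map _ _ = a • TensorProduct.map _ _
          rw [PiTensorProduct.map_update_smul, TensorProduct.map_smul_right,
            TensorProduct.map_smul_left] }
      (fun X Y => ?_) ?_ (ρ j) (ht j) _ (h j)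
    · change β (PiTensorProduct.map _) = β (PiTensorProduct.map _) * β (PiTensorProduct.map _)
      rw [← map_mul, ← PiTensorProduct.map_mul]
      congr 2
      funext k
      by_cases hk : k = j
      · subst hk; simp
      · simp [hk]
    · change β (PiTensorProduct.map _) = 1
      rw [Function.update_eq_self]
      exact (congrArg β PiTensorProduct.map_one).trans (map_one β)
  refine ⟨TensorProduct.map (TensorProduct.map r₀ (PiTensorProduct.map r)) r₁ t, ?_⟩
  have hcomp : TensorProduct.map (TensorProduct.map i₀ (PiTensorProduct.map i)) i₁ ∘ₗ
      TensorProduct.map (TensorProduct.map r₀ (PiTensorProduct.map r)) r₁ =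
      TensorProduct.map (TensorProduct.map (i₀ ∘ₗ r₀) LinearMap.id) LinearMap.id ∘ₗ
      β (PiTensorProduct.map fun j => i j ∘ₗ r j) ∘ₗ
      TensorProduct.map (TensorProduct.map LinearMap.id LinearMap.id) (i₁ ∘ₗ r₁) := by
    change _ = _ ∘ₗ TensorProduct.map _ _ ∘ₗ _
    simp only [← TensorProduct.map_comp, PiTensorProduct.map_comp, LinearMap.id_comp,
      LinearMap.comp_id]
  have := LinearMap.congr_fun hcomp t
  simp only [LinearMap.comp_apply] at this
  rw [this, e₁, e, e₀]

end Fixed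

/-- A left inverse of the inclusion of the intertwining maps in the linear maps. -/
theorem exists_leftInverse_toLinearMapl {G V W : Type*} [Group G] [AddCommGroup V] [Module ℂ V]
    [AddCommGroup W] [Module ℂ W] (ρ : Representation ℂ G V) (σ : Representation ℂ G W) :
    ∃ r : (V →ₗ[ℂ] W) →ₗ[ℂ] Representation.IntertwiningMap ρ σ,
      r ∘ₗ Representation.IntertwiningMap.toLinearMapl ρ σ = LinearMap.id ∧
      ∀ T : V →ₗ[ℂ] W, (∀ g, Representation.linHom ρ σ g T = T) →
        Representation.IntertwiningMap.toLinearMapl ρ σ (r T) = T := by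
  -- Any linear retraction will do; its values off the intertwiners play no role.
  obtain ⟨r, hr⟩ := LinearMap.exists_leftInverse_of_injective
    (Representation.IntertwiningMap.toLinearMapl ρ σ)
    (LinearMap.ker_eq_bot.2 (Representation.IntertwiningMap.toLinearMap_injective ρ σ))
  refine ⟨r, hr, fun T hT => ?_⟩
  have hmem : ∃ Y, Representation.IntertwiningMap.toLinearMapl ρ σ Y = T := by
    refine ⟨⟨T, fun g => ?_⟩, rfl⟩
    conv_lhs => rw [← hT g]
    ext x
    simp
  obtain ⟨Y, rfl⟩ := hmem
  rw [← LinearMap.comp_apply r, hr]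
  rfl

/-! ### Equivariance -/

section Equivariance

variable {G : Type*} [Group G] {m : ℕ} {H K : Subgroup G}
  {M : Fin (m + 1) → Type u} [∀ i, AddCommGroup (M i)] [∀ i, Module ℂ (M i)]
  (π : ∀ i, Representation ℂ G (M i))
  {L : Type*} [AddCommGroup L] [Module ℂ L] (σL : Representation ℂ H L)
  {S : Fin m → Type v} [∀ j, AddCommGroup (S j)] [∀ j, Module ℂ (S j)]
  (σ : ∀ j, Representation ℂ G (S j))
  {N : Type*} [AddCommGroup N] [Module ℂ N] (σN : Representation ℂ K N)

/-- The vertex components can be prescribed independently, so gauge invariance of a decoration can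
be tested on each tensor factor separately. -/
theorem exists_gauge (h : H) (γ : Fin m → G) (k : K) :
    ∃ κ : GaugeGroup (linearGauge m H K),
      gaugeFirst m H K κ = h ∧ gaugeBulk m H K κ = γ ∧ gaugeLast m H K κ = k := by
  let w : Fin (m + 2) → G := Fin.cons (h : G) (Fin.snoc γ (k : G))
  have hw : ∀ v, w v ∈ linearGauge m H K v := by
    intro v
    induction v using Fin.cases with
    | zero => rw [linearGauge_zero]; exact h.2
    | succ v =>
      induction v using Fin.lastCases with
      | last =>
        rw [Fin.succ_last, linearGauge_last]
        simp [w, ← Fin.succ_last]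
      | cast j => rw [Fin.succ_castSucc, linearGauge_bulk]; trivial
  refine ⟨fun v => ⟨w v, hw v⟩, Subtype.ext rfl, funext fun j => ?_, Subtype.ext ?_⟩
  · change w j.succ.castSucc = γ j
    rw [← Fin.succ_castSucc]
    simp [w]
  · change w (Fin.last (m + 1)) = k
    rw [← Fin.succ_last]
    simp [w]

theorem gaugeAct_gaugeAct_inv {V E : Type*} (Γ : OrientedGraph V E) {K : V → Subgroup G}
    (k : GaugeGroup K) (g : E → G) : gaugeAct Γ k (gaugeAct Γ k⁻¹ g) = g := by
  funext e
  simp [gaugeAct, mul_assoc]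

/-- The action of `H × G^m × K` on the decorations. -/
def decorationAct (h : H) (γ : Fin m → G) (k : K) : Module.End ℂ (Decorations M L S N) :=
  TensorProduct.map (TensorProduct.map (Representation.linHom (resRep (π 0) H) σL h)
    (PiTensorProduct.map fun j => Representation.linHom (π j.succ)
      (Representation.tprod (π j.castSucc) (σ j)) (γ j)))
    (Representation.linHom σN.dual (resRep (π (Fin.last m)) K) k)

/-- A telescoping product: conjugating the decorations by the gauge values `w` cancels the `w` at
both ends of every edge. What survives is the action on the outer legs `L`, `S j` and `N`. -/
theorem sphericalFunction_gaugeAct [FiniteDimensional ℂ N] (κ : GaugeGroup (linearGauge m H K))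
    (g : Fin (m + 1) → G) (Θ : M 0 →ₗ[ℂ] L)
    (Φ : ∀ j : Fin m, M j.succ →ₗ[ℂ] M j.castSucc ⊗[ℂ] S j)
    (Ξ : Module.Dual ℂ N →ₗ[ℂ] M (Fin.last m)) :
    sphericalFunction π (Representation.linHom (resRep (π 0) H) σL (gaugeFirst m H K κ) Θ)
      (fun j => Representation.linHom (π j.succ)
        (Representation.tprod (π j.castSucc) (σ j)) (gaugeBulk m H K κ j) (Φ j))
      (Representation.linHom σN.dual (resRep (π (Fin.last m)) K) (gaugeLast m H K κ) Ξ)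
      (gaugeAct (linearGraph m) κ g) =
    linearSpinRep m H K σL σ σN κ (sphericalFunction π Θ Φ Ξ g) := by
  let w : Fin (m + 2) → G := fun v => κ v
  have hnat := chainComp_natural m M S (fun j => Φ j ∘ₗ π j.succ (g j.succ))
    (fun j => Representation.linHom (π j.succ)
        (Representation.tprod (π j.castSucc) (σ j)) (gaugeBulk m H K κ j) (Φ j) ∘ₗ
          π j.succ (gaugeAct (linearGraph m) κ g j.succ))
    -- The vector space of the edge `i` is moved by the gauge value at the target of that edge; the
    -- source value is absorbed by the preceding link.
    (fun i => π i (w i.succ)) (fun j => σ j (gaugeBulk m H K κ j)) (fun j x => by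
      change TensorProduct.map (π j.castSucc (w j.succ.castSucc)) (σ j (w j.succ.castSucc))
        (Φ j (π j.succ (w j.succ.castSucc)⁻¹ (π j.succ
          (w j.succ.castSucc * g j.succ * (w j.succ.succ)⁻¹) (π j.succ (w j.succ.succ) x)))) =
        TensorProduct.map (π j.castSucc (w j.succ.castSucc)) (σ j (w j.succ.castSucc))
          (Φ j (π j.succ (g j.succ) x))
      simp only [← Module.End.mul_apply, ← map_mul]
      congr 5
      group)
  -- The dual action of the inverse is the plain transpose of `σN`, the form required by
  -- `spinQ_comp`.
  have hΞ : Representation.linHom σN.dual (resRep (π (Fin.last m)) K) (gaugeLast m H K κ) Ξ =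
      π (Fin.last m) (w (Fin.last m).succ) ∘ₗ Ξ ∘ₗ (σN (gaugeLast m H K κ)).dualMap := by
    ext ψ
    simp [resRep, Representation.dual]
    rfl
  have hmap : ∀ z : M 0 ⊗[ℂ] (⨂[ℂ] j, S j),
      LinearMap.rTensor (⨂[ℂ] j, S j) (Representation.linHom (resRep (π 0) H) σL
        (gaugeFirst m H K κ) Θ ∘ₗ π 0 (gaugeAct (linearGraph m) κ g 0))
        (TensorProduct.map (π 0 (w (Fin.succ 0)))
          (PiTensorProduct.map fun j => σ j (gaugeBulk m H K κ j)) z) =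
      TensorProduct.map (σL (gaugeFirst m H K κ))
        (PiTensorProduct.map fun j => σ j (gaugeBulk m H K κ j))
        (LinearMap.rTensor (⨂[ℂ] j, S j) (Θ ∘ₗ π 0 (g 0)) z) := by
    intro z
    induction z using TensorProduct.induction_on with
    | zero => simp
    | add y z hy hz => simp only [map_add, hy, hz]
    | tmul x p =>
      simp only [TensorProduct.map_tmul, LinearMap.rTensor_tmul]
      congr 1
      change σL _ (Θ (π 0 (w 0)⁻¹ (π 0 (w 0 * g 0 * (w (Fin.succ 0))⁻¹) (π 0 (w (Fin.succ 0)) x))))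
        = σL _ (Θ (π 0 (g 0) x))
      simp only [← Module.End.mul_apply, ← map_mul]
      congr 5
      group
  have hcomp : LinearMap.rTensor (⨂[ℂ] j, S j) (Representation.linHom (resRep (π 0) H) σL
        (gaugeFirst m H K κ) Θ ∘ₗ π 0 (gaugeAct (linearGraph m) κ g 0)) ∘ₗ
      chainComp m M S (fun j => Representation.linHom (π j.succ)
        (Representation.tprod (π j.castSucc) (σ j)) (gaugeBulk m H K κ j) (Φ j) ∘ₗ
          π j.succ (gaugeAct (linearGraph m) κ g j.succ)) ∘ₗ
      Representation.linHom σN.dual (resRep (π (Fin.last m)) K) (gaugeLast m H K κ) Ξ =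
      TensorProduct.map (σL (gaugeFirst m H K κ))
        (PiTensorProduct.map fun j => σ j (gaugeBulk m H K κ j)) ∘ₗ
      (LinearMap.rTensor (⨂[ℂ] j, S j) (Θ ∘ₗ π 0 (g 0)) ∘ₗ
        chainComp m M S (fun j => Φ j ∘ₗ π j.succ (g j.succ)) ∘ₗ Ξ) ∘ₗ
      (σN (gaugeLast m H K κ)).dualMap := by
    rw [hΞ]
    ext1 ψ
    simp only [LinearMap.comp_apply]
    rw [hnat, hmap]
  rw [sphericalFunction, hcomp, spinQ_comp]
  rfl

theorem sphericalMapAt_decorationAct [FiniteDimensional ℂ N]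
    (κ : GaugeGroup (linearGauge m H K)) (g : Fin (m + 1) → G) (t : Decorations M L S N) :
    sphericalMapAt π (gaugeAct (linearGraph m) κ g)
      (decorationAct π σL σ σN (gaugeFirst m H K κ) (gaugeBulk m H K κ) (gaugeLast m H K κ) t) =
    linearSpinRep m H K σL σ σN κ (sphericalMapAt π g t) := by
  suffices h : sphericalMapAt π (gaugeAct (linearGraph m) κ g) ∘ₗ
      decorationAct π σL σ σN (gaugeFirst m H K κ) (gaugeBulk m H K κ) (gaugeLast m H K κ) =
    linearSpinRep m H K σL σ σN κ ∘ₗ sphericalMapAt π g from LinearMap.congr_fun h t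
  refine TensorProduct.ext (TensorProduct.ext (LinearMap.ext fun Θ =>
    PiTensorProduct.ext (MultilinearMap.ext fun Φ => LinearMap.ext fun Ξ => ?_)))
  change sphericalMapAt π _ (decorationAct π σL σ σN _ _ _
    ((Θ ⊗ₜ PiTensorProduct.tprod ℂ Φ) ⊗ₜ Ξ)) =
    linearSpinRep m H K σL σ σN κ (sphericalMapAt π g ((Θ ⊗ₜ PiTensorProduct.tprod ℂ Φ) ⊗ₜ Ξ))
  rw [sphericalMapAt_tmul, ← sphericalFunction_gaugeAct, decorationAct, TensorProduct.map_tmul,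
    TensorProduct.map_tmul, PiTensorProduct.map_tprod, sphericalMapAt_tmul]

end Equivariance

/-! ### Gauge invariant decorations and the isomorphism. -/

theorem linHom_comp_toLinearMapl {G V W : Type*} [Group G] [AddCommGroup V] [Module ℂ V]
    [AddCommGroup W] [Module ℂ W] (ρ : Representation ℂ G V) (τ : Representation ℂ G W) (g : G) :
    Representation.linHom ρ τ g ∘ₗ Representation.IntertwiningMap.toLinearMapl ρ τ =
      Representation.IntertwiningMap.toLinearMapl ρ τ := by
  ext T x
  simp [← T.isIntertwining]

section Main

variable {G : Type*} [Group G] {m : ℕ} {H K : Subgroup G}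
  {M : Fin (m + 1) → Type u} [∀ i, AddCommGroup (M i)] [∀ i, Module ℂ (M i)]
  [∀ i, FiniteDimensional ℂ (M i)] (π : ∀ i, Representation ℂ G (M i))
  {L : Type*} [AddCommGroup L] [Module ℂ L] [FiniteDimensional ℂ L] (σL : Representation ℂ H L)
  {S : Fin m → Type v} [∀ j, AddCommGroup (S j)] [∀ j, Module ℂ (S j)]
  [∀ j, FiniteDimensional ℂ (S j)] (σ : ∀ j, Representation ℂ G (S j))
  {N : Type*} [AddCommGroup N] [Module ℂ N] [FiniteDimensional ℂ N] (σN : Representation ℂ K N)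

/-- The inclusion of the equivariant decorations in all decorations. -/
def equivariantInclusion :
    (Representation.IntertwiningMap (resRep (π 0) H) σL ⊗[ℂ]
      (⨂[ℂ] j : Fin m, Representation.IntertwiningMap (π j.succ)
        (Representation.tprod (π j.castSucc) (σ j)))) ⊗[ℂ]
      Representation.IntertwiningMap σN.dual (resRep (π (Fin.last m)) K) →ₗ[ℂ]
    Decorations M L S N :=
  TensorProduct.map (TensorProduct.map
    (Representation.IntertwiningMap.toLinearMapl (resRep (π 0) H) σL)
    (PiTensorProduct.map fun j : Fin m => Representation.IntertwiningMap.toLinearMapl (π j.succ)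
      (Representation.tprod (π j.castSucc) (σ j))))
    (Representation.IntertwiningMap.toLinearMapl σN.dual (resRep (π (Fin.last m)) K))

omit [∀ i, FiniteDimensional ℂ (M i)] [FiniteDimensional ℂ L] [∀ j, FiniteDimensional ℂ (S j)]
  [FiniteDimensional ℂ N] in
-- Linear left inverses of the factors tensor to a left inverse of the whole.
theorem equivariantInclusion_injective :
    Function.Injective (equivariantInclusion π σL σ σN) := by
  obtain ⟨r₀, h₀, -⟩ := exists_leftInverse_toLinearMapl (resRep (π 0) H) σL
  choose r h _ using fun j : Fin m => exists_leftInverse_toLinearMapl (π j.succ)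
    (Representation.tprod (π j.castSucc) (σ j))
  obtain ⟨r₁, h₁, -⟩ := exists_leftInverse_toLinearMapl σN.dual (resRep (π (Fin.last m)) K)
  refine Function.LeftInverse.injective
    (g := TensorProduct.map (TensorProduct.map r₀ (PiTensorProduct.map r)) r₁) fun t => ?_
  rw [equivariantInclusion, ← LinearMap.comp_apply, ← TensorProduct.map_comp,
    ← TensorProduct.map_comp, ← PiTensorProduct.map_comp, h₀, h₁]
  simp only [h, PiTensorProduct.map_id, TensorProduct.map_id, LinearMap.id_apply]

omit [∀ i, FiniteDimensional ℂ (M i)] [FiniteDimensional ℂ L] [∀ j, FiniteDimensional ℂ (S j)]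
  [FiniteDimensional ℂ N] in
theorem decorationAct_equivariantInclusion (h : H) (γ : Fin m → G) (k : K) (t) :
    decorationAct π σL σ σN h γ k (equivariantInclusion π σL σ σN t) =
      equivariantInclusion π σL σ σN t := by
  rw [equivariantInclusion, decorationAct, ← LinearMap.comp_apply, ← TensorProduct.map_comp,
    ← TensorProduct.map_comp, ← PiTensorProduct.map_comp]
  simp only [linHom_comp_toLinearMapl]

/-- Setting all gauge components but one equal to 1 gives the slotwise invariance needed for
`mem_range_map_of_fixed`. -/
theorem mem_range_equivariantInclusion {t : Decorations M L S N}
    (ht : ∀ h γ k, decorationAct π σL σ σN h γ k t = t) :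
    t ∈ LinearMap.range (equivariantInclusion π σL σ σN) := by
  obtain ⟨r₀, -, h₀⟩ := exists_leftInverse_toLinearMapl (resRep (π 0) H) σL
  choose r _ h using fun j : Fin m => exists_leftInverse_toLinearMapl (π j.succ)
    (Representation.tprod (π j.castSucc) (σ j))
  obtain ⟨r₁, -, h₁⟩ := exists_leftInverse_toLinearMapl σN.dual (resRep (π (Fin.last m)) K)
  have hone : (PiTensorProduct.map fun j => Representation.linHom (π j.succ)
      (Representation.tprod (π j.castSucc) (σ j)) ((1 : Fin m → G) j)) = LinearMap.id := by
    simp only [Pi.one_apply, map_one]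
    exact PiTensorProduct.map_one
  refine mem_range_map_of_fixed _ (fun j => Representation.linHom (π j.succ)
    (Representation.tprod (π j.castSucc) (σ j))) _ _ _ _ r₀ r r₁ h₀ h h₁
    (fun g => ?_) (fun j g => ?_) fun g => ?_
  · have := ht g 1 1
    rwa [decorationAct, hone, map_one] at this
  · have hsingle : (fun k => Representation.linHom (π k.succ)
        (Representation.tprod (π k.castSucc) (σ k)) ((Pi.mulSingle j g : Fin m → G) k)) =
        Function.update (fun _ => 1) j (Representation.linHom (π j.succ)
          (Representation.tprod (π j.castSucc) (σ j)) g) := by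
      funext k
      by_cases hk : k = j
      · subst hk; simp
      · simp [hk]
    have := ht 1 (Pi.mulSingle j g) 1
    rw [decorationAct, map_one, map_one, hsingle] at this
    exact this
  · have := ht 1 1 g
    rw [decorationAct, hone, map_one] at this
    exact this

theorem exists_linearEquiv_elementarySpinGraphFunctions [TopologicalSpace G]
    (hπcont : ∀ i, IsContinuousRep (π i)) (hπirr : ∀ i, (π i).IsIrreducible) :
    ∃ F : (Representation.IntertwiningMap (resRep (π 0) H) σL ⊗[ℂ]
          (⨂[ℂ] j : Fin m, Representation.IntertwiningMap (π j.succ)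
            (Representation.tprod (π j.castSucc) (σ j)))) ⊗[ℂ]
          Representation.IntertwiningMap σN.dual (resRep (π (Fin.last m)) K) ≃ₗ[ℂ]
        elementarySpinGraphFunctions (linearGraph m) (linearGauge m H K) (piTensorRep π)
          (linearSpinRep m H K σL σ σN),
      ∀ t, (F t : (Fin (m + 1) → G) → (L ⊗[ℂ] (⨂[ℂ] j, S j)) ⊗[ℂ] N) =
        sphericalMap π (equivariantInclusion π σL σ σN t) := by
  have hinj := sphericalMap_injective π (L := L) (S := S) (N := N)
    fun i => span_range_eq_top_of_isIrreducible (π i) (hπirr i)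
  have hrange := range_sphericalMap π (L := L) (S := S) (N := N) hπcont
  let f := (sphericalMap π).comp (equivariantInclusion π σL σ σN)
  have hf : ∀ t, f t ∈ elementarySpinGraphFunctions (linearGraph m) (linearGauge m H K)
      (piTensorRep π) (linearSpinRep m H K σL σ σN) := fun t => by
    refine ⟨hrange ▸ ⟨_, rfl⟩, fun κ g => ?_⟩
    have := sphericalMapAt_decorationAct π σL σ σN κ g (equivariantInclusion π σL σ σN t)
    rwa [decorationAct_equivariantInclusion] at this
  refine ⟨LinearEquiv.ofBijective (f.codRestrict _ hf) ⟨?_, ?_⟩, fun t => rfl⟩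
  · intro s t hst
    exact equivariantInclusion_injective π σL σ σN (hinj (congrArg Subtype.val hst))
  · rintro ⟨φ, hφ, hφκ⟩
    rw [← hrange] at hφ
    obtain ⟨t, rfl⟩ := hφ
    -- The decoration `t` is fixed: f_{k·t}(g) = σ(k) f_t(k⁻¹·g) = f_t(g) by equivariance of f_t,
    -- and injectivity gives k·t = t.
    obtain ⟨s, hs⟩ := mem_range_equivariantInclusion π σL σ σN (t := t) fun h γ k => by
      obtain ⟨κ, rfl, rfl, rfl⟩ := exists_gauge h γ k
      refine hinj (funext fun g => ?_)
      rw [← gaugeAct_gaugeAct_inv (linearGraph m) κ g, hφκ]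
      exact sphericalMapAt_decorationAct π σL σ σN κ _ t
    exact ⟨s, Subtype.ext (congrArg (sphericalMap π) hs)⟩

end Main

end SpinGraph

end

theorem mainTheorem5
    {𝔤 : Type*} [NormedAddCommGroup 𝔤] [NormedSpace ℝ 𝔤] [FiniteDimensional ℝ 𝔤]
    {X : Type*} [TopologicalSpace X] (I : ModelWithCorners ℝ 𝔤 X) [I.Boundaryless]
    {G : Type*} [Group G] [TopologicalSpace G] [ChartedSpace X G] [LieGroup I ∞ G]
    [T2Space G] [CompactSpace G] [ConnectedSpace G]
    (H K : Subgroup G) (m : ℕ)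
    (M : Fin (m + 1) → Type*) [∀ i, AddCommGroup (M i)] [∀ i, Module ℂ (M i)]
    [∀ i, FiniteDimensional ℂ (M i)]
    (π : ∀ i, Representation ℂ G (M i))
    (hπcont : ∀ i, SpinGraph.IsContinuousRep (π i)) (hπirr : ∀ i, (π i).IsIrreducible)
    (L : Type*) [AddCommGroup L] [Module ℂ L] [FiniteDimensional ℂ L] (σL : Representation ℂ H L)
    (S : Fin m → Type*) [∀ j, AddCommGroup (S j)] [∀ j, Module ℂ (S j)]
    [∀ j, FiniteDimensional ℂ (S j)] (σ : ∀ j, Representation ℂ G (S j))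
    (N : Type*) [AddCommGroup N] [Module ℂ N] [FiniteDimensional ℂ N] (σN : Representation ℂ K N) :
    ∃ F : (Representation.IntertwiningMap (SpinGraph.resRep (π 0) H) σL ⊗[ℂ]
          (⨂[ℂ] j : Fin m, Representation.IntertwiningMap (π j.succ)
            (Representation.tprod (π j.castSucc) (σ j)))) ⊗[ℂ]
          Representation.IntertwiningMap σN.dual (SpinGraph.resRep (π (Fin.last m)) K) ≃ₗ[ℂ]
        SpinGraph.elementarySpinGraphFunctions (SpinGraph.linearGraph m)
          (SpinGraph.linearGauge m H K) (SpinGraph.piTensorRep π)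
          (SpinGraph.linearSpinRep m H K σL σ σN),
      ∀ (Θ : Representation.IntertwiningMap (SpinGraph.resRep (π 0) H) σL)
        (Φ : ∀ j : Fin m, Representation.IntertwiningMap (π j.succ)
          (Representation.tprod (π j.castSucc) (σ j)))
        (Ξ : Representation.IntertwiningMap σN.dual (SpinGraph.resRep (π (Fin.last m)) K))
        (g : Fin (m + 1) → G),
        (F ((Θ ⊗ₜ[ℂ] PiTensorProduct.tprod ℂ Φ) ⊗ₜ[ℂ] Ξ) :
            (Fin (m + 1) → G) → (L ⊗[ℂ] (⨂[ℂ] j, S j)) ⊗[ℂ] N) g =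
          SpinGraph.sphericalFunction π Θ.toLinearMap (fun j => (Φ j).toLinearMap)
            Ξ.toLinearMap g := by
  obtain ⟨F, hF⟩ := SpinGraph.exists_linearEquiv_elementarySpinGraphFunctions π σL σ σN hπcont hπirr
  refine ⟨F, fun Θ Φ Ξ g => ?_⟩
  rw [hF, SpinGraph.equivariantInclusion, TensorProduct.map_tmul, TensorProduct.map_tmul,
    PiTensorProduct.map_tprod]
  exact SpinGraph.sphericalMapAt_tmul π g _ _ _
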